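/- There are $J$ items with order-up-to levels $Q=(Q_1,\dots,Q_J)\in\mathbb Z^J$, demand rates $\lambda_j\ge 0$ with $\Lambda=\sum_j\lambda_j>0$, demand probabilities $p_j=\lambda_j/\Lambda$, stockout costs $b_j$, a fixed replenishment cost $A$ and a constant lead time $\tau\ge 0$. The state space is $\mathcal S=\{i\in\mathbb Z^J: i\le Q\}$, and $\mathcal U\subseteq\mathcal S$ is a trigger set with $Q\notin\mathcal U$; write $\overline{\mathcal U}=\mathcal S\setminus\mathcal U$. The system starts in $Q$. In a continuation state $i\in\overline{\mathcal U}$ it waits an exponential time with rate $\Lambda$ at no cost and then moves to $i^{-j}$ (one unit of item $j$ fewer) with probability $p_j$. In a trigger state $i\in\mathcal U$ it stays for the time $\tau$, incurs on entering $i$ the cost $A+\sum_j b_j\max(D_j(\tau)-i_j,0)$ with independent Poisson lead-time demands $D_j(\tau)$ of mean $\lambda_j\tau$, and then returns to $Q$. All these random choices are independent. Let $$G(i)=A+\sum_{j=1}^J b_j\sum_{r=i_j}^\infty (r-i_j)\,P(D_j(\tau)=r),\qquad P(m\mid i)=\sum_{j:\,m=i^{-j}}p_j ,$$ and let $\delta(m,Q)=1$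 if $m=Q$ and $0$ otherwise. The embedded chain moves from $i$ to $m$ with probability $P(m\mid i)$ if $i\notin\mathcal U$ and $\delta(m,Q)$ if $i\in\mathcal U$. Assume that the expected number of transitions from $Q$ until $\mathcal U$ is first entered is finite; this holds in particular whenever $\overline{\mathcal U}$ is finite. Then the embedded chain has a unique stationary distribution $\pi$. It is also the unique absolutely summable real solution of $$\pi_m=\delta(m,Q)\sum_{i\in\mathcal U}\pi_i+\sum_{i\in\overline{\mathcal U}}P(m\mid i)\,\pi_i\quad(m\in\mathcal S),\qquad \sum_{i\in\mathcal U}\pi_i+\sum_{i\in\overline{\mathcal U}}\pi_i=1 .$$ Moreover, the numerator series below converges absolutely, the denominator is positive, and the long-run expected average cost per unit time is $$\alpha_{\mathcal U}=\frac{\sum_{i\in\mathcal U}G(i)\,\pi_i}{\frac1\Lambda\sum_{i\in\overline{\mathcal U}}\pi_i+\tau\sum_{i\in\mathcal U}\pi_i}\,,$$ in both of the following senses. The total cost $C(t)$ incurred up to time $t$ is integrable and $E[C(t)]/t\to\alpha_{\mathcal U}$ as $t\to\infty$. Almost surely, the total cost incurred in the first $m$ visited states divided by the total time spent in them converges to $\alpha_{\mathcal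 U}$ as $m\to\infty$. -/

import Mathlib

open MeasureTheory ProbabilityTheory Filter Topology Set
open scoped ENNReal NNReal

noncomputable section

/-- Data of a replenishment problem with `J` items: order-up-to levels `Q`, Poisson demand rates
`rate`, stockout costs `b`, fixed replenishment cost `A` and lead time `tau`. -/
structure IVM (J : ℕ) where
  Q : Fin J → ℤ
  rate : Fin J → ℝ
  b : Fin J → ℝ
  A : ℝ
  tau : ℝ
  rate_nonneg : ∀ j, 0 ≤ rate j
  total_pos : 0 < ∑ j, rate j
  tau_nonneg : 0 ≤ tau

namespace IVM

variable {J : ℕ} (M : IVM J)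

/-- The total demand rate `Λ`. -/
def Lam : ℝ := ∑ j, M.rate j

/-- The probability that a demand is a demand for item `j`. -/
def p (j : Fin J) : ℝ := M.rate j / M.Lam

/-- The state space: integer inventory vectors `i ≤ Q` (negative entries record stockouts). -/
abbrev State : Type := Set.Iic M.Q

/-- The full machine, which is the initial state of every replenishment cycle. -/
def full : M.State := ⟨M.Q, Set.mem_Iic.mpr le_rfl⟩

/-- The state with one fewer unit of item `j`. -/
def dec (i : M.State) (j : Fin J) : M.State :=
  ⟨i.1 - Pi.single j 1, Set.mem_Iic.mpr <|
    (sub_le_self i.1 (Pi.single_nonneg.mpr (zero_le_one : (0 : ℤ) ≤ 1))).trans i.2⟩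

/-- The law of the demand `D_j(τ)` during the lead time: Poisson with mean `λ_j τ`. -/
def leadLaw (j : Fin J) : Measure ℕ := poissonMeasure (M.rate j * M.tau).toNNReal

/-- `P(D_j(τ) = r)` for an integer `r` (it is zero for `r < 0`). -/
def leadProb (j : Fin J) (r : ℤ) : ℝ := (M.leadLaw j).real {n : ℕ | (n : ℤ) = r}

/-- The expected immediate cost `G(i) = A + ∑ⱼ bⱼ ∑_{r ≥ iⱼ} (r - iⱼ) P(Dⱼ(τ) = r)` of stopping. -/
def G (i : M.State) : ℝ :=
  M.A + ∑ j, M.b j * ∑' r : Set.Ici (i.1 j), ((r : ℤ) - i.1 j : ℝ) * M.leadProb j r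

open Classical in
/-- Transition probability `P(m | i)` of the uniformized demand chain. -/
def P (m i : M.State) : ℝ := ∑ j, if m = M.dec i j then M.p j else 0

open Classical in
/-- The indicator `δ(m, Q)`. -/
def delta (m : M.State) : ℝ := if m = M.full then 1 else 0

open Classical in
/-- Transition probability `P_U(m | i)` of the embedded chain with trigger set `U`. -/
def PU (U : Set M.State) (m i : M.State) : ℝ := if i ∈ U then M.delta m else M.P m i

/-- `π` is a stationary probability distribution of the embedded chain. -/
def IsStationary (U : Set M.State) (π : M.State → ℝ) : Prop :=
  (∀ i, 0 ≤ π i) ∧ HasSum π 1 ∧ ∀ m, HasSum (fun i => M.PU U m i * π i) (π m)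

/-- `π` is an absolutely summable solution of the balance equations together with the
normalization; no sign condition is imposed. -/
def SolvesBalance (U : Set M.State) (π : M.State → ℝ) : Prop :=
  Summable π ∧
  (∀ m, π m = M.delta m * ∑' i : U, π i + ∑' i : (Uᶜ : Set M.State), M.P m i * π i) ∧
  (∑' i : U, π i) + ∑' i : (Uᶜ : Set M.State), π i = 1

/-- `(∑_{i ∈ U} G(i) πᵢ) / ((1/Λ) ∑_{i ∉ U} πᵢ + τ ∑_{i ∈ U} πᵢ)`. -/
def costRatio (U : Set M.State) (π : M.State → ℝ) : ℝ :=
  (∑' i : U, M.G i * π i) /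
    (1 / M.Lam * ∑' i : (Uᶜ : Set M.State), π i + M.tau * ∑' i : U, π i)

/-! The random process. One step of the system consumes a triple: the item of the next demand,
the time until that demand (both used in continuation states), and the vector of lead-time demands
(used in trigger states). -/

/-- The randomness of one step. -/
abbrev Step (J : ℕ) : Type := Fin J × ℝ × (Fin J → ℕ)

/-- The law of one step: the item is `j` with probability `λ_j / Λ`, the waiting time is exponential
with rate `Λ`, the lead-time demands are Poisson with means `λ_j τ`, all independent. -/
def stepLaw : Measure (Step J) :=
  (∑ j, ENNReal.ofReal (M.p j) • Measure.dirac j).prod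
    ((expMeasure M.Lam).prod (Measure.pi M.leadLaw))

/-- `ξ` is an i.i.d. sequence of steps of the system. -/
structure IsDriving {Ω : Type*} [MeasurableSpace Ω] (μ : Measure Ω)
    (ξ : ℕ → Ω → Step J) : Prop where
  meas : ∀ k, Measurable (ξ k)
  indep : iIndepFun ξ μ
  law : ∀ k, μ.map (ξ k) = M.stepLaw

open Classical in
/-- The state `i^k` visited after `k` transitions: start full, lose one unit of the demanded item
in a continuation state, return to full from a trigger state. -/
def state (U : Set M.State) (x : ℕ → Step J) : ℕ → M.State
  | 0 => M.full
  | k + 1 => if state U x k ∈ U then M.full else M.dec (state U x k) (x k).1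

open Classical in
/-- Time `T(i^k)` spent in the `k`-th visited state. -/
def holdTime (U : Set M.State) (x : ℕ → Step J) (k : ℕ) : ℝ :=
  if M.state U x k ∈ U then M.tau else (x k).2.1

open Classical in
/-- Cost `C(i^k)` incurred in the `k`-th visited state. In a trigger state `i` it consists of the
fixed cost and of `b_j` for each of the `(D_j - i_j)⁺` units of item `j` that are short at the
arrival of the replenishment; in a continuation state it is zero. -/
def stepCost (U : Set M.State) (x : ℕ → Step J) (k : ℕ) : ℝ :=
  if M.state U x k ∈ U then
    M.A + ∑ j, M.b j * max (((x k).2.2 j : ℝ) - ((M.state U x k).1 j : ℝ)) 0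
  else 0

/-- The time at which the `k`-th visited state is entered. -/
def epoch (U : Set M.State) (x : ℕ → Step J) (k : ℕ) : ℝ :=
  ∑ l ∈ Finset.range k, M.holdTime U x l

open Classical in
/-- The total cost incurred up to time `t`. -/
def totalCost (U : Set M.State) (x : ℕ → Step J) (t : ℝ) : ℝ :=
  ∑' k, if M.epoch U x k ≤ t then M.stepCost U x k else 0

/-- The number of transitions until a trigger state is first entered (`∞` if this never
happens). -/
def triggerStep (U : Set M.State) (x : ℕ → Step J) : ℝ≥0∞ :=
  ⨅ (k : ℕ) (_ : M.state U x k ∈ U), (k : ℝ≥0∞)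

end IVM

end

/-! Visiting a trigger state ends a cycle, and the process then starts afresh from the full state.
On sequences of steps let θ be the map `nextCycle` that discards the first cycle. It preserves the
i.i.d. law (`measurePreserving_nextCycle`) and is independent of the duration and of the cost F of
the discarded cycle. Hence F, F∘θ, F∘θ², … are the values of the successive cycles, and both
averages converge to the mean cost of a cycle divided by its mean duration: almost surely by the
strong law, in expectation by a renewal reward theorem.

The link with π is that each demand removes one unit. Within a cycle `level` grows by one per step,
so a state i is visited at most once, and only at step `level i`. Let v_i be the probability of this
visit in the first cycle, and N the mean number of steps to a trigger. Then v_Q = 1, v sums to 1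
over U and to N over the complement, and conditioning on the previous state gives the balance
equations away from Q. These equations express the value at m by values one level closer to Q, so by
induction on the level every solution, of whatever sign, is a multiple of v; normalization leaves
only π = v / (1 + N). The randomness used in state i is independent of the visit to i. This gives
the mean duration N/Λ + τ and the mean cost ∑ G(i) v_i over U, and the factor 1 + N cancels in the
ratio. The cost is integrable because its mean grows at most linearly in the level of the trigger
state, which is the number of steps taken to reach it.

The renewal reward theorem must allow costs of either sign, paid inside a cycle. With m(t) the
renewal function and h(s) the mean reward earned within time s of the start of a cycle, the expected
cost up to t is the convolution of h with the renewal measure. Since h(s) tends to the mean cycle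
reward, replacing h by this limit costs at most ε m(t) + K (m(t) − m(t − L)). After division by t,
the elementary renewal theorem makes this arbitrarily small. -/

noncomputable section

/-! ### Independent blocks generated by a measure-preserving map -/

section Regeneration

variable {X : Type*} [MeasurableSpace X] {P : Measure X} {θ : X → X}

lemma measurable_birkhoffSum (hθ : Measurable θ) {F : X → ℝ} (hF : Measurable F) (n : ℕ) :
    Measurable (birkhoffSum θ F n) := by
  unfold birkhoffSum
  exact Finset.measurable_sum _ fun i _ => hF.comp (hθ.iterate i)

lemma IndepFun.comp_measurePreserving {β γ : Type*} [MeasurableSpace β] [MeasurableSpace γ]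
    {f : X → β} {g : X → γ} (h : IndepFun f g P) (hf : Measurable f) (hg : Measurable g)
    (hθ : MeasurePreserving θ P P) : IndepFun (f ∘ θ) (g ∘ θ) P := by
  rw [indepFun_iff_measure_inter_preimage_eq_mul] at h ⊢
  intro s t hs ht
  rw [preimage_comp, preimage_comp, ← preimage_inter,
    hθ.measure_preimage ((hf hs).inter (hg ht)).nullMeasurableSet,
    hθ.measure_preimage (hf hs).nullMeasurableSet, hθ.measure_preimage (hg ht).nullMeasurableSet]
  exact h s t hs ht

lemma map_prodMk_of_indep [IsProbabilityMeasure P]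
    (hθ : MeasurePreserving θ P P) {F : X → ℝ} (hF : Measurable F)
    (hind : IndepFun F θ P) : P.map (fun x => (F x, θ x)) = (P.map F).prod P := by
  have := (indepFun_iff_map_prod_eq_prod_map_map hF.aemeasurable hθ.measurable.aemeasurable).1 hind
  rwa [hθ.map_eq] at this

/-- With S_n the Birkhoff sum, S_{n+1} = F + S_n∘θ and θ^{n+1} = θ^n∘θ are functions of the pair (F,
θ), whose law is a product. Freezing the value u of F reduces the claim to the induction hypothesis
with `s` translated by u. -/
lemma indepFun_birkhoffSum_iterate [IsProbabilityMeasure P]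
    (hθ : MeasurePreserving θ P P) {F : X → ℝ} (hF : Measurable F)
    (hind : IndepFun F θ P) (n : ℕ) : IndepFun (birkhoffSum θ F n) (θ^[n]) P := by
  induction n with
  | zero =>
    have : birkhoffSum θ F 0 = fun _ => 0 := by ext; simp
    rw [this]
    exact indepFun_const_left 0 _
  | succ n ih =>
    rw [indepFun_iff_measure_inter_preimage_eq_mul] at ih ⊢
    intro s t hs ht
    have hS := measurable_birkhoffSum hθ.measurable hF n
    have hB := hθ.measurable.iterate n
    have hpair : Measurable fun x => (F x, θ x) := hF.prodMk hθ.measurable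
    have hadd : Measurable fun q : ℝ × X => q.1 + birkhoffSum θ F n q.2 :=
      measurable_fst.add (hS.comp measurable_snd)
    have hB2 : Measurable fun q : ℝ × X => θ^[n] q.2 := hB.comp measurable_snd
    have e1 : birkhoffSum θ F (n + 1) ⁻¹' s
        = (fun x => (F x, θ x)) ⁻¹' ((fun q : ℝ × X => q.1 + birkhoffSum θ F n q.2) ⁻¹' s) := by
      ext x; simp [birkhoffSum_succ']
    have e2 : θ^[n + 1] ⁻¹' t = (fun x => (F x, θ x)) ⁻¹' ((fun q : ℝ × X => θ^[n] q.2) ⁻¹' t) := by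
      ext x; simp
    have e3 : P (θ^[n + 1] ⁻¹' t) = P (θ^[n] ⁻¹' t) := by
      rw [(hθ.iterate _).measure_preimage ht.nullMeasurableSet,
        (hθ.iterate _).measure_preimage ht.nullMeasurableSet]
    rw [e3, e1, e2, ← preimage_inter, ← Measure.map_apply hpair ((hadd hs).inter (hB2 ht)),
      ← Measure.map_apply hpair (hadd hs), map_prodMk_of_indep hθ hF hind,
      Measure.prod_apply ((hadd hs).inter (hB2 ht)), Measure.prod_apply (hadd hs),
      ← lintegral_mul_const _ (measurable_measure_prodMk_left (hadd hs))]
    refine lintegral_congr fun u => ?_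
    exact ih ((fun a => u + a) ⁻¹' s) t ((measurable_const_add u) hs) ht

/-- F is independent of every function of θ, hence of each later F∘θ^(d+1); precomposing both with
θ^m does not change their joint law. -/
lemma pairwise_indepFun_iterate (hθ : MeasurePreserving θ P P) {F : X → ℝ} (hF : Measurable F)
    (hind : IndepFun F θ P) :
    Pairwise (Function.onFun (fun f g => IndepFun f g P) fun n => F ∘ θ^[n]) := by
  have key : ∀ m d : ℕ, IndepFun (F ∘ θ^[m]) (F ∘ θ^[m + d + 1]) P := by
    intro m d
    have h1 : IndepFun F ((F ∘ θ^[d]) ∘ θ) P :=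
      hind.comp measurable_id (hF.comp (hθ.measurable.iterate d))
    have := IndepFun.comp_measurePreserving h1 hF
      ((hF.comp (hθ.measurable.iterate d)).comp hθ.measurable) (hθ.iterate m)
    convert this using 1
    ext x
    simp only [Function.comp_apply]
    rw [← Function.iterate_succ_apply, ← Function.iterate_add_apply]
    congr 2; omega
  intro m n hmn
  rcases lt_or_gt_of_ne hmn with h | h
  · obtain ⟨d, rfl⟩ := Nat.exists_eq_add_of_lt h
    exact key m d
  · obtain ⟨d, rfl⟩ := Nat.exists_eq_add_of_lt h
    exact (key n d).symm

/-- The strong law asks only for pairwise independence, so joint independence of the blocks is not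
needed. -/
lemma tendsto_birkhoffSum_div [IsProbabilityMeasure P]
    (hθ : MeasurePreserving θ P P) {F : X → ℝ} (hF : Measurable F)
    (hint : Integrable F P) (hind : IndepFun F θ P) :
    ∀ᵐ x ∂P, Tendsto (fun n : ℕ => birkhoffSum θ F n x / n) atTop (𝓝 (∫ x, F x ∂P)) := by
  have := strong_law_ae (μ := P) (fun n => F ∘ θ^[n]) (by simpa using hint)
    (pairwise_indepFun_iterate hθ hF hind) (fun n => by
      refine ⟨(hF.comp (hθ.measurable.iterate n)).aemeasurable, by simpa using hF.aemeasurable, ?_⟩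
      rw [← Measure.map_map hF (hθ.measurable.iterate n), (hθ.iterate n).map_eq]; simp)
  filter_upwards [this] with x hx
  refine hx.congr fun n => ?_
  simp [birkhoffSum, div_eq_inv_mul]

lemma ae_forall_iterate (hθ : MeasurePreserving θ P P) {p : X → Prop} (h : ∀ᵐ x ∂P, p x) :
    ∀ᵐ x ∂P, ∀ n, p (θ^[n] x) :=
  ae_all_iff.2 fun n => (hθ.iterate n).quasiMeasurePreserving.ae h

end Regeneration

/-! ### The elementary renewal theorem -/

section ElementaryRenewal

/-- The steps that begin by time t overshoot t by at most one step, so by at most c. The bound `s K`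
is carried along because the induction needs it when `s K ≤ t`. -/
lemma sum_ite_le_min {a s : ℕ → ℝ} {c t : ℝ} (ha : ∀ n, 0 ≤ a n) (hac : ∀ n, a n ≤ c)
    (h0 : s 0 = 0) (hs : ∀ n, s (n + 1) = s n + a n) (ht : 0 ≤ t) (K : ℕ) :
    ∑ n ∈ Finset.range K, (if s n ≤ t then a n else 0) ≤ min (s K) (t + c) := by
  induction K with
  | zero => simp [h0]; linarith [ha 0, hac 0]
  | succ K ih =>
    rw [Finset.sum_range_succ, hs]
    rw [le_min_iff] at ih ⊢
    split_ifs with h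
    · constructor <;> linarith [ha K, hac K]
    · constructor <;> linarith [ha K]

lemma min_le_sum_ite {a s : ℕ → ℝ} {t : ℝ} (ha : ∀ n, 0 ≤ a n)
    (h0 : s 0 = 0) (hs : ∀ n, s (n + 1) = s n + a n) (K : ℕ) :
    min (s K) t ≤ ∑ n ∈ Finset.range K, (if s n ≤ t then a n else 0) := by
  have hmono : Monotone s := monotone_nat_of_le_succ fun n => by rw [hs]; linarith [ha n]
  have hsum : ∀ K, s K = ∑ n ∈ Finset.range K, a n := by
    intro K
    induction K with
    | zero => simpa using h0
    | succ K ih => rw [hs, Finset.sum_range_succ, ih]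
  induction K with
  | zero => simp [h0]
  | succ K ih =>
    by_cases h : s K ≤ t
    · refine (min_le_left _ _).trans ?_
      rw [hsum]
      refine le_of_eq (Finset.sum_congr rfl fun n hn => ?_)
      rw [if_pos ((hmono (Nat.lt_succ_iff.1 (Finset.mem_range.1 hn))).trans h)]
    · rw [Finset.sum_range_succ, if_neg h, add_zero]
      rw [min_eq_right (not_le.1 h).le] at ih
      exact (min_le_right _ _).trans ih

variable {X : Type*} [MeasurableSpace X] {P : Measure X} {θ : X → X} {T : X → ℝ}

lemma measurableSet_birkhoffSum_le (hθ : Measurable θ) (hT : Measurable T) (n : ℕ)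
    (t : ℝ) : MeasurableSet {x | birkhoffSum θ T n x ≤ t} :=
  measurableSet_le (measurable_birkhoffSum hθ hT n) measurable_const

lemma integrable_ite_birkhoffSum_le (hθ : MeasurePreserving θ P P) (hT : Measurable T)
    {F : X → ℝ} (hFi : Integrable F P) (n : ℕ) (t : ℝ) :
    Integrable (fun x => if birkhoffSum θ T n x ≤ t then F (θ^[n] x) else 0) P := by
  have := ((hθ.iterate n).integrable_comp_of_integrable hFi).indicator
    (measurableSet_birkhoffSum_le hθ.measurable hT n t)
  exact this

/-- The mean of the truncated variable. -/
def truncMean (P : Measure X) (T : X → ℝ) (c : ℝ) : ℝ := ∫ x, min (T x) c ∂P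

lemma tendsto_truncMean (hint : Integrable T P) (h0 : ∀ᵐ x ∂P, 0 ≤ T x) :
    Tendsto (truncMean P T) atTop (𝓝 (∫ x, T x ∂P)) := by
  unfold truncMean
  refine tendsto_integral_filter_of_dominated_convergence (fun x => ‖T x‖) ?_ ?_ hint.norm ?_
  · exact Eventually.of_forall fun c => hint.aestronglyMeasurable.inf aestronglyMeasurable_const
  · filter_upwards [eventually_ge_atTop 0] with c hc
    filter_upwards [h0] with x hx
    rw [Real.norm_of_nonneg hx, Real.norm_of_nonneg (le_min hx hc)]
    exact min_le_left _ _
  · refine ae_of_all _ fun x => tendsto_const_nhds.congr' ?_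
    filter_upwards [eventually_ge_atTop (T x)] with c hc
    rw [min_eq_left hc]

variable [IsProbabilityMeasure P]

/-- The basis of Wald's identity: whether the n-th renewal occurs by t is independent of θ^n, hence
of what the n-th cycle contributes. -/
lemma integral_ite_birkhoffSum_le (hθ : MeasurePreserving θ P P) (hT : Measurable T)
    (hind : IndepFun T θ P) {F : X → ℝ} (hF : Measurable F) (n : ℕ) (t : ℝ) :
    ∫ x, (if birkhoffSum θ T n x ≤ t then F (θ^[n] x) else 0) ∂P
      = P.real {x | birkhoffSum θ T n x ≤ t} * ∫ x, F x ∂P := by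
  have h1 : IndepFun ((Iic t).indicator (1 : ℝ → ℝ) ∘ birkhoffSum θ T n) (F ∘ θ^[n]) P :=
    (indepFun_birkhoffSum_iterate hθ hT hind n).comp (measurable_one.indicator measurableSet_Iic) hF
  have h2 := h1.integral_mul_eq_mul_integral
    ((measurable_one.indicator measurableSet_Iic).comp
      (measurable_birkhoffSum hθ.measurable hT n)).aestronglyMeasurable
    (hF.comp (hθ.measurable.iterate n)).aestronglyMeasurable
  have h3 : ∫ x, F (θ^[n] x) ∂P = ∫ x, F x ∂P := by
    rw [← integral_map (hθ.measurable.iterate n).aemeasurable hF.aestronglyMeasurable,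
      (hθ.iterate n).map_eq]
  have h4 : ∫ x, ((Iic t).indicator (1 : ℝ → ℝ) ∘ birkhoffSum θ T n) x ∂P
      = P.real {x | birkhoffSum θ T n x ≤ t} := by
    rw [← integral_indicator_one (measurableSet_birkhoffSum_le hθ.measurable hT n t)]
    rfl
  rw [h4] at h2
  simp only [Function.comp_apply] at h2
  rw [h3] at h2
  rw [← h2]
  refine integral_congr_ae (ae_of_all _ fun x => ?_)
  simp [indicator]

/-- The expected number of renewals up to time `t`. -/
def renewalFun (P : Measure X) (θ : X → X) (T : X → ℝ) (t : ℝ) : ℝ :=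
  ∑' n, P.real {x | birkhoffSum θ T n x ≤ t}

/-- By Wald's identity the left side is the mean total length of those among the first K steps that
begin by t, and the overshoot is at most c. -/
lemma mul_sum_measureReal_le (hθ : MeasurePreserving θ P P) {F : X → ℝ} (hF : Measurable F)
    {c t : ℝ} (h0 : ∀ᵐ x ∂P, 0 ≤ F x) (hc : ∀ x, F x ≤ c) (hind : IndepFun F θ P) (ht : 0 ≤ t)
    (K : ℕ) :
    (∫ x, F x ∂P) * ∑ n ∈ Finset.range K, P.real {x | birkhoffSum θ F n x ≤ t} ≤ t + c := by
  have hFi : Integrable F P := by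
    refine Integrable.of_bound hF.aestronglyMeasurable c ?_
    filter_upwards [h0] with x hx
    rw [Real.norm_of_nonneg hx]; exact hc x
  rw [Finset.mul_sum]
  have : ∀ n, (∫ x, F x ∂P) * P.real {x | birkhoffSum θ F n x ≤ t}
      = ∫ x, (if birkhoffSum θ F n x ≤ t then F (θ^[n] x) else 0) ∂P := fun n => by
    rw [integral_ite_birkhoffSum_le hθ hF hind hF, mul_comm]
  simp_rw [this]
  rw [← integral_finsetSum _ fun n _ => integrable_ite_birkhoffSum_le hθ hF hFi n t]
  have hb : ∀ᵐ x ∂P, ∑ n ∈ Finset.range K, (if birkhoffSum θ F n x ≤ t then F (θ^[n] x) else 0)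
      ≤ t + c := by
    filter_upwards [ae_forall_iterate hθ h0] with x hx
    exact (sum_ite_le_min (a := fun n => F (θ^[n] x)) (s := fun n => birkhoffSum θ F n x)
      hx (fun _ => hc _) (by simp) (fun n => by simp [birkhoffSum_succ]) ht K).trans
      (min_le_right _ _)
  calc _ ≤ ∫ _, (t + c) ∂P := integral_mono_ae
        (integrable_finsetSum _ fun n _ => integrable_ite_birkhoffSum_le hθ hF hFi n t)
        (integrable_const _) hb
    _ = t + c := by simp

/-- Truncation bounds the overshoot, and it shortens the partial sums, so it can only raise the
probabilities of renewals by t. -/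
lemma truncMean_mul_sum_le (hθ : MeasurePreserving θ P P) (hT : Measurable T)
    (h0 : ∀ᵐ x ∂P, 0 ≤ T x) (hind : IndepFun T θ P) {c t : ℝ} (hc : 0 ≤ c) (ht : 0 ≤ t) (K : ℕ) :
    truncMean P T c * ∑ n ∈ Finset.range K, P.real {x | birkhoffSum θ T n x ≤ t} ≤ t + c := by
  have hmin : Measurable fun u : ℝ => min u c := measurable_id.min measurable_const
  have h0' : ∀ᵐ x ∂P, 0 ≤ min (T x) c := h0.mono fun x hx => le_min hx hc
  refine le_trans ?_ (mul_sum_measureReal_le hθ (hmin.comp hT) (c := c) h0'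
    (fun x => min_le_right _ _) (hind.comp hmin measurable_id) ht K)
  refine mul_le_mul_of_nonneg_left (Finset.sum_le_sum fun n _ => ?_) (integral_nonneg_of_ae h0')
  refine measureReal_mono fun x (hx : birkhoffSum θ T n x ≤ t) => ?_
  refine le_trans (Finset.sum_le_sum fun k _ => ?_) hx
  exact min_le_left _ _

lemma summable_measureReal_birkhoffSum_le (hθ : MeasurePreserving θ P P) (hT : Measurable T)
    (hint : Integrable T P) (h0 : ∀ᵐ x ∂P, 0 ≤ T x) (hpos : 0 < ∫ x, T x ∂P)
    (hind : IndepFun T θ P) (t : ℝ) :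
    Summable fun n => P.real {x | birkhoffSum θ T n x ≤ t} := by
  obtain ⟨c, hc0, hc⟩ := (((tendsto_truncMean hint h0).eventually (lt_mem_nhds hpos)).and
    (eventually_ge_atTop 0)).exists.imp fun c h => h.symm
  -- The bound on partial sums needs a nonnegative time, hence the detour through |t|.
  refine Summable.of_nonneg_of_le (fun _ => measureReal_nonneg) (fun n => ?_)
    (summable_of_sum_range_le (c := (|t| + c) / truncMean P T c) (fun _ => measureReal_nonneg)
      fun K => ?_) (f := fun n => P.real {x | birkhoffSum θ T n x ≤ |t|})
  · exact measureReal_mono fun x (hx : _ ≤ t) => hx.trans (le_abs_self t)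
  · rw [le_div_iff₀ hc, mul_comm]
    exact truncMean_mul_sum_le hθ hT h0 hind hc0 (abs_nonneg t) K

lemma truncMean_mul_renewalFun_le (hθ : MeasurePreserving θ P P) (hT : Measurable T)
    (hint : Integrable T P) (h0 : ∀ᵐ x ∂P, 0 ≤ T x) (hpos : 0 < ∫ x, T x ∂P)
    (hind : IndepFun T θ P) {c t : ℝ} (hc : 0 ≤ c) (ht : 0 ≤ t) :
    truncMean P T c * renewalFun P θ T t ≤ t + c := by
  have h := (summable_measureReal_birkhoffSum_le hθ hT hint h0 hpos hind
    t).hasSum.tendsto_sum_nat.const_mul (truncMean P T c)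
  exact le_of_tendsto h (Eventually.of_forall fun K => truncMean_mul_sum_le hθ hT h0 hind hc ht K)

/-- Wald's identity without truncation: the steps that begin by t together cover [0, t]. -/
lemma le_integral_mul_renewalFun (hθ : MeasurePreserving θ P P) (hT : Measurable T)
    (hint : Integrable T P) (h0 : ∀ᵐ x ∂P, 0 ≤ T x) (hpos : 0 < ∫ x, T x ∂P)
    (hind : IndepFun T θ P) {t : ℝ} (ht : 0 ≤ t) :
    t ≤ (∫ x, T x ∂P) * renewalFun P θ T t := by
  have hsum := summable_measureReal_birkhoffSum_le hθ hT hint h0 hpos hind t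
  have h := hsum.hasSum.tendsto_sum_nat.const_mul (∫ x, T x ∂P)
  -- The first K steps are sure to cover [0, t] only when the K-th sum exceeds t. The probability of
  -- the opposite event is a term of a convergent series, so it vanishes as K grows.
  have h2 : Tendsto (fun K => t * (1 - P.real {x | birkhoffSum θ T K x ≤ t})) atTop (𝓝 t) := by
    simpa using ((tendsto_const_nhds (x := (1 : ℝ))).sub hsum.tendsto_atTop_zero).const_mul t
  refine le_of_tendsto_of_tendsto' h2 h fun K => ?_
  rw [Finset.mul_sum]
  have : ∀ n, (∫ x, T x ∂P) * P.real {x | birkhoffSum θ T n x ≤ t}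
      = ∫ x, (if birkhoffSum θ T n x ≤ t then T (θ^[n] x) else 0) ∂P := fun n => by
    rw [integral_ite_birkhoffSum_le hθ hT hind hT, mul_comm]
  simp_rw [this]
  rw [← integral_finsetSum _ fun n _ => integrable_ite_birkhoffSum_le hθ hT hint n t]
  have hms := measurableSet_birkhoffSum_le hθ.measurable hT K t
  have e : t * (1 - P.real {x | birkhoffSum θ T K x ≤ t})
      = ∫ x, {x | birkhoffSum θ T K x ≤ t}ᶜ.indicator (fun _ => t) x ∂P := by
    rw [integral_indicator_const _ hms.compl, probReal_compl_eq_one_sub hms, smul_eq_mul, mul_comm]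
  rw [e]
  refine integral_mono_ae ((integrable_const t).indicator hms.compl)
    (integrable_finsetSum _ fun n _ => integrable_ite_birkhoffSum_le hθ hT hint n t) ?_
  filter_upwards [ae_forall_iterate hθ h0] with x hx
  have := min_le_sum_ite (a := fun n => T (θ^[n] x)) (s := fun n => birkhoffSum θ T n x)
      (t := t) hx (by simp) (fun n => by simp [birkhoffSum_succ]) K
  refine le_trans ?_ this
  by_cases hK : birkhoffSum θ T K x ≤ t
  · rw [indicator_of_notMem (by simpa using hK)]
    exact le_min (Finset.sum_nonneg fun k _ => hx k) ht
  · rw [indicator_of_mem (by simpa using hK), min_eq_right (not_le.1 hK).le]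

/-- The elementary renewal theorem. -/
lemma tendsto_renewalFun_div (hθ : MeasurePreserving θ P P) (hT : Measurable T)
    (hint : Integrable T P) (h0 : ∀ᵐ x ∂P, 0 ≤ T x) (hpos : 0 < ∫ x, T x ∂P)
    (hind : IndepFun T θ P) :
    Tendsto (fun t => renewalFun P θ T t / t) atTop (𝓝 (∫ x, T x ∂P)⁻¹) := by
  rw [tendsto_order]
  constructor
  · intro a ha
    filter_upwards [eventually_gt_atTop 0] with t ht
    refine ha.trans_le ?_
    rw [le_div_iff₀ ht, inv_mul_le_iff₀ hpos]
    exact le_integral_mul_renewalFun hθ hT hint h0 hpos hind ht.le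
  · intro a ha
    -- The truncation level is chosen so that the inverse truncated mean is still below a; the
    -- overshoot then adds only a term of order c / t.
    obtain ⟨c, ⟨hc1, hc2⟩, hc0⟩ := ((((tendsto_truncMean hint h0).inv₀ hpos.ne').eventually
      (gt_mem_nhds ha)).and ((tendsto_truncMean hint h0).eventually (lt_mem_nhds hpos))).and
        (eventually_ge_atTop 0) |>.exists
    have hlim : Tendsto (fun t : ℝ => (truncMean P T c)⁻¹ * (1 + c / t)) atTop
        (𝓝 ((truncMean P T c)⁻¹)) := by
      simpa using ((tendsto_const_nhds (x := (1 : ℝ))).add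
        (tendsto_const_nhds.div_atTop tendsto_id)).const_mul (truncMean P T c)⁻¹
    filter_upwards [eventually_gt_atTop 0, hlim.eventually (gt_mem_nhds hc1)] with t ht h2
    refine lt_of_le_of_lt ?_ h2
    have h1 := truncMean_mul_renewalFun_le hθ hT hint h0 hpos hind hc0 ht.le
    rw [le_inv_mul_iff₀ hc2, div_eq_mul_inv, ← mul_assoc, ← div_eq_mul_inv, div_le_iff₀ ht]
    calc _ ≤ t + c := h1
      _ = _ := by field_simp

end ElementaryRenewal

/-! ### The renewal reward theorem in expectation -/

section RenewalReward

variable {X : Type*} [MeasurableSpace X] {P : Measure X} {θ : X → X} {T W R : X → ℝ}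

/-- The mean reward earned in a cycle within time `s` of its start. -/
def earlyReward (P : Measure X) (W R : X → ℝ) (s : ℝ) : ℝ := ∫ x, (if W x ≤ s then R x else 0) ∂P

/-- The reward of the `n`-th cycle if it is earned by time `t`. -/
def cycleReward (θ : X → X) (T W R : X → ℝ) (t : ℝ) (n : ℕ) (x : X) : ℝ :=
  if birkhoffSum θ T n x + W (θ^[n] x) ≤ t then R (θ^[n] x) else 0

lemma integrable_ite_le (hW : Measurable W) (hR : Integrable R P) (s : ℝ) :
    Integrable (fun x => if W x ≤ s then R x else 0) P :=
  hR.indicator (measurableSet_le hW measurable_const)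

lemma abs_earlyReward_le (hW : Measurable W) (hR : Integrable R P) (s : ℝ) :
    |earlyReward P W R s| ≤ ∫ x, |R x| ∂P := by
  refine (norm_integral_le_integral_norm _).trans
    (integral_mono (integrable_ite_le hW hR s).norm hR.norm fun x => ?_)
  simp only
  split_ifs <;> simp

lemma earlyReward_of_neg (h0 : ∀ᵐ x ∂P, 0 ≤ W x) {s : ℝ} (hs : s < 0) :
    earlyReward P W R s = 0 := by
  refine integral_eq_zero_of_ae ?_
  filter_upwards [h0] with x hx
  rw [if_neg (by linarith)]; rfl

lemma tendsto_earlyReward (hW : Measurable W) (hR : Integrable R P) :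
    Tendsto (earlyReward P W R) atTop (𝓝 (∫ x, R x ∂P)) := by
  unfold earlyReward
  refine tendsto_integral_filter_of_dominated_convergence (fun x => ‖R x‖) ?_ ?_ hR.norm ?_
  · exact Eventually.of_forall fun s => (integrable_ite_le hW hR s).aestronglyMeasurable
  · refine Eventually.of_forall fun s => ae_of_all _ fun x => ?_
    split_ifs <;> simp
  · refine ae_of_all _ fun x => tendsto_const_nhds.congr' ?_
    filter_upwards [eventually_ge_atTop (W x)] with s hs
    rw [if_pos hs]

/-- If `h` is close to its limit `g` beyond `L` and vanishes on the negative axis, then its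
distance to `g · 1_{[0, ∞)}` is small outside `[0, L)`. -/
lemma exists_abs_sub_le {h : ℝ → ℝ} {g C : ℝ} (hneg : ∀ s < 0, h s = 0) (hC : ∀ s, |h s| ≤ C)
    (hlim : Tendsto h atTop (𝓝 g)) {ε : ℝ} (hε : 0 < ε) :
    ∃ L, 0 ≤ L ∧ ∀ t s : ℝ, |h (t - s) - g * (if s ≤ t then 1 else 0)| ≤
      ε * (if s ≤ t then 1 else 0) +
        (C + |g|) * ((if s ≤ t then 1 else 0) - (if s ≤ t - L then 1 else 0)) := by
  obtain ⟨L, hL⟩ := eventually_atTop.1 ((Metric.tendsto_nhds.1 hlim) ε hε)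
  refine ⟨max L 0, le_max_right _ _, fun t s => ?_⟩
  have hL0 := le_max_right L 0
  rcases lt_or_ge t s with h1 | h1
  · rw [if_neg (not_le.2 h1), if_neg (by linarith), hneg _ (by linarith)]; simp
  · rw [if_pos h1]
    split_ifs with h2
    · have := hL (t - s) (by linarith [le_max_left L 0])
      rw [Real.dist_eq] at this
      simpa using this.le
    · have h3 := abs_sub (h (t - s)) g
      have := hC (t - s)
      simp only [mul_one, sub_zero]
      linarith

lemma integrable_tsum_of_summable {F : ℕ → X → ℝ} (hF : ∀ n, Integrable (F n) P)
    (hs : Summable fun n => ∫ x, ‖F n x‖ ∂P) : Integrable (fun x => ∑' n, F n x) P := by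
  have hfin : ∫⁻ x, ∑' n, ‖F n x‖ₑ ∂P < ∞ := by
    rw [lintegral_tsum fun n => (hF n).aestronglyMeasurable.enorm]
    simp_rw [← ofReal_integral_norm_eq_lintegral_enorm (hF _)]
    exact hs.tsum_ofReal_lt_top
  have hae : ∀ᵐ x ∂P, Summable fun n => F n x := by
    filter_upwards [ae_lt_top' (AEMeasurable.tsum fun n =>
      (hF n).aestronglyMeasurable.enorm) hfin.ne] with x hx
    refine Summable.of_norm ?_
    have h : ∑' n, ENNReal.ofNNReal ‖F n x‖₊ ≠ ∞ := hx.ne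
    exact NNReal.summable_coe.2 (ENNReal.tsum_coe_ne_top_iff_summable.1 h)
  refine ⟨aestronglyMeasurable_of_tendsto_ae atTop
    (fun n => (integrable_finsetSum (Finset.range n) fun k _ => hF k).aestronglyMeasurable)
    (hae.mono fun x hx => hx.hasSum.tendsto_sum_nat), ?_⟩
  exact (lintegral_mono fun x => enorm_tsum_le_tsum_enorm).trans_lt hfin

lemma measurable_cycleReward (hθ : MeasurePreserving θ P P) (hT : Measurable T) (hW : Measurable W)
    (hR : Measurable R) (t : ℝ) (n : ℕ) : Measurable (cycleReward θ T W R t n) := by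
  have h := hθ.measurable.iterate n
  exact Measurable.ite (measurableSet_le ((measurable_birkhoffSum hθ.measurable hT n).add
    (hW.comp h)) measurable_const) (hR.comp h) measurable_const

omit [MeasurableSpace X] in
lemma abs_cycleReward_le {t : ℝ} {n : ℕ} {x : X} (h : 0 ≤ W (θ^[n] x)) :
    |cycleReward θ T W R t n x| ≤ if birkhoffSum θ T n x ≤ t then |R (θ^[n] x)| else 0 := by
  unfold cycleReward
  split_ifs with h1 h2
  · exact le_rfl
  · exact absurd (by linarith) h2
  · simp
  · simp

lemma integrable_cycleReward (hθ : MeasurePreserving θ P P) (hT : Measurable T)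
    (hW : Measurable W) (hR : Measurable R) (hRi : Integrable R P) (t : ℝ) (n : ℕ) :
    Integrable (cycleReward θ T W R t n) P := by
  refine ((hθ.iterate n).integrable_comp_of_integrable hRi).norm.mono'
    (measurable_cycleReward hθ hT hW hR t n).aestronglyMeasurable (ae_of_all _ fun x => ?_)
  unfold cycleReward
  split_ifs <;> simp

variable [IsProbabilityMeasure P]

lemma integral_abs_cycleReward_le (hθ : MeasurePreserving θ P P) (hT : Measurable T)
    (hind : IndepFun T θ P) (hW : Measurable W) (hW0 : ∀ᵐ x ∂P, 0 ≤ W x)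
    (hR : Measurable R) (hRi : Integrable R P) (t : ℝ) (n : ℕ) :
    ∫ x, ‖cycleReward θ T W R t n x‖ ∂P
      ≤ P.real {x | birkhoffSum θ T n x ≤ t} * ∫ x, |R x| ∂P := by
  rw [← integral_ite_birkhoffSum_le hθ hT hind hR.abs]
  refine integral_mono_ae (integrable_cycleReward hθ hT hW hR hRi t n).norm
    (integrable_ite_birkhoffSum_le hθ hT hRi.abs n t) ?_
  filter_upwards [ae_forall_iterate hθ hW0] with x hx
  exact abs_cycleReward_le (hx n)

/-- Given that the n-th cycle starts at s, it is a fresh copy of the first, and its reward counts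
when it is earned within t − s. This is Fubini for the product law of the start and θ^n. -/
lemma integral_cycleReward (hθ : MeasurePreserving θ P P) (hT : Measurable T)
    (hind : IndepFun T θ P) (hW : Measurable W) (hR : Measurable R) (hRi : Integrable R P)
    (t : ℝ) (n : ℕ) :
    ∫ x, cycleReward θ T W R t n x ∂P
      = ∫ x, earlyReward P W R (t - birkhoffSum θ T n x) ∂P := by
  have hS := measurable_birkhoffSum hθ.measurable hT n
  have hB := hθ.measurable.iterate n
  have hprod := (indepFun_iff_map_prod_eq_prod_map_map hS.aemeasurable hB.aemeasurable).1
    (indepFun_birkhoffSum_iterate hθ hT hind n)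
  rw [(hθ.iterate n).map_eq] at hprod
  let f : ℝ × X → ℝ := fun q => if q.1 + W q.2 ≤ t then R q.2 else 0
  have hf : Measurable f := Measurable.ite (measurableSet_le
    (measurable_fst.add (hW.comp measurable_snd)) measurable_const) (hR.comp measurable_snd)
    measurable_const
  have hpair : Measurable fun x => (birkhoffSum θ T n x, θ^[n] x) := hS.prodMk hB
  have : IsProbabilityMeasure (P.map (birkhoffSum θ T n)) :=
    Measure.isProbabilityMeasure_map hS.aemeasurable
  have hfi : Integrable f ((P.map (birkhoffSum θ T n)).prod P) := by
    rw [← hprod]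
    exact (integrable_map_measure hf.aestronglyMeasurable hpair.aemeasurable).2
      (integrable_cycleReward hθ hT hW hR hRi t n)
  calc ∫ x, cycleReward θ T W R t n x ∂P
      = ∫ x, f (birkhoffSum θ T n x, θ^[n] x) ∂P := rfl
    _ = ∫ q, f q ∂((P.map (birkhoffSum θ T n)).prod P) := by
        rw [← hprod, integral_map hpair.aemeasurable hf.aestronglyMeasurable]
    _ = ∫ s, (∫ y, f (s, y) ∂P) ∂(P.map (birkhoffSum θ T n)) := integral_prod _ hfi
    _ = ∫ x, (∫ y, f (birkhoffSum θ T n x, y) ∂P) ∂P :=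
        integral_map hS.aemeasurable hfi.integral_prod_left.aestronglyMeasurable
    _ = _ := by
        refine integral_congr_ae (ae_of_all _ fun x => ?_)
        simp only [f, earlyReward, le_sub_iff_add_le']

section

variable (hθ : MeasurePreserving θ P P) (hT : Measurable T) (hTi : Integrable T P)
  (hT0 : ∀ᵐ x ∂P, 0 ≤ T x) (hpos : 0 < ∫ x, T x ∂P) (hind : IndepFun T θ P)
  (hW : Measurable W) (hW0 : ∀ᵐ x ∂P, 0 ≤ W x) (hR : Measurable R) (hRi : Integrable R P)

include hθ hT hTi hT0 hpos hind hW hW0 hR hRi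

lemma summable_integral_norm_cycleReward (t : ℝ) :
    Summable fun n => ∫ x, ‖cycleReward θ T W R t n x‖ ∂P :=
  Summable.of_nonneg_of_le (fun _ => integral_nonneg fun _ => norm_nonneg _)
    (fun n => integral_abs_cycleReward_le hθ hT hind hW hW0 hR hRi t n)
    ((summable_measureReal_birkhoffSum_le hθ hT hTi hT0 hpos hind t).mul_right _)

lemma integrable_tsum_cycleReward (t : ℝ) :
    Integrable (fun x => ∑' n, cycleReward θ T W R t n x) P :=
  integrable_tsum_of_summable
    (fun n => integrable_cycleReward hθ hT hW hR hRi t n)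
    (summable_integral_norm_cycleReward hθ hT hTi hT0 hpos hind hW hW0 hR hRi t)

lemma hasSum_integral_cycleReward (t : ℝ) :
    HasSum (fun n => ∫ x, earlyReward P W R (t - birkhoffSum θ T n x) ∂P)
      (∫ x, ∑' n, cycleReward θ T W R t n x ∂P) := by
  simp_rw [← integral_cycleReward hθ hT hind hW hR hRi]
  exact hasSum_integral_of_summable_integral_norm
    (fun n => integrable_cycleReward hθ hT hW hR hRi t n)
    (summable_integral_norm_cycleReward hθ hT hTi hT0 hpos hind hW hW0 hR hRi t)

/-- This is `exists_abs_sub_le` at the start of the n-th cycle, integrated and summed over n. What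
matters is that L and K do not depend on t. -/
lemma exists_abs_integral_tsum_sub_le {ε : ℝ} (hε : 0 < ε) :
    ∃ L K, 0 ≤ L ∧ ∀ t, |∫ x, ∑' n, cycleReward θ T W R t n x ∂P
        - (∫ x, R x ∂P) * renewalFun P θ T t| ≤
      ε * renewalFun P θ T t + K * (renewalFun P θ T t - renewalFun P θ T (t - L)) := by
  set g := ∫ x, R x ∂P with hg
  set C := ∫ x, |R x| ∂P with hCdef
  obtain ⟨L, hL0, hL⟩ := exists_abs_sub_le (h := earlyReward P W R)
    (fun s hs => earlyReward_of_neg hW0 hs) (abs_earlyReward_le hW hRi)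
    (tendsto_earlyReward hW hRi) hε
  refine ⟨L, C + |g|, hL0, fun t => ?_⟩
  have hs := summable_measureReal_birkhoffSum_le hθ hT hTi hT0 hpos hind
  have h1 := hasSum_integral_cycleReward hθ hT hTi hT0 hpos hind hW hW0 hR hRi t
  have h2 := h1.sub ((hs t).hasSum.mul_left g)
  have h3 := ((hs t).hasSum.mul_left ε).add
    (((hs t).hasSum.sub (hs (t - L)).hasSum).mul_left (C + |g|))
  have hI : ∀ n u, ∫ x, (if birkhoffSum θ T n x ≤ u then (1 : ℝ) else 0) ∂P
      = P.real {x | birkhoffSum θ T n x ≤ u} := fun n u => by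
    rw [← integral_indicator_one (measurableSet_birkhoffSum_le hθ.measurable hT n u)]; rfl
  have hIi : ∀ n u, Integrable (fun x => if birkhoffSum θ T n x ≤ u then (1 : ℝ) else 0) P :=
    fun n u => (integrable_const (1 : ℝ)).indicator
      (measurableSet_birkhoffSum_le hθ.measurable hT n u)
  have hterm : ∀ n, ‖∫ x, earlyReward P W R (t - birkhoffSum θ T n x) ∂P
      - g * P.real {x | birkhoffSum θ T n x ≤ t}‖ ≤
      ε * P.real {x | birkhoffSum θ T n x ≤ t} + (C + |g|) *
        (P.real {x | birkhoffSum θ T n x ≤ t} - P.real {x | birkhoffSum θ T n x ≤ t - L}) := by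
    intro n
    have hEi : Integrable (fun x => earlyReward P W R (t - birkhoffSum θ T n x)) P := by
      refine Integrable.of_bound ?_ C
        (ae_of_all _ fun x => abs_earlyReward_le hW hRi _)
      have hm : StronglyMeasurable (earlyReward P W R) := by
        refine StronglyMeasurable.integral_prod_right
          (f := fun (s : ℝ) (x : X) => if W x ≤ s then R x else 0) ?_
        exact (Measurable.ite (measurableSet_le (hW.comp measurable_snd) measurable_fst)
          (hR.comp measurable_snd) measurable_const).stronglyMeasurable
      exact (hm.comp_measurable ((measurable_birkhoffSum hθ.measurable hT n).const_sub
        t)).aestronglyMeasurable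
    rw [← hI, ← hI, ← integral_const_mul, ← integral_const_mul, ← integral_sub (hIi _ _) (hIi _ _),
      ← integral_const_mul, ← integral_sub hEi ((hIi _ _).const_mul _)]
    refine le_trans ?_ (integral_add ((hIi n t).const_mul ε)
      (((hIi n t).sub (hIi n (t - L))).const_mul (C + |g|))).le
    refine (norm_integral_le_integral_norm _).trans (integral_mono
      (hEi.sub ((hIi _ _).const_mul _)).norm
      (((hIi _ _).const_mul _).add (((hIi _ _).sub (hIi _ _)).const_mul _)) fun x => ?_)
    exact hL t _
  have h4 := tsum_of_norm_bounded h3 hterm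
  rw [h2.tsum_eq] at h4
  exact h4

/-- The renewal reward theorem in expectation, for rewards earned at any moment of their cycle. -/
lemma tendsto_integral_tsum_cycleReward_div :
    Tendsto (fun t => (∫ x, ∑' n, cycleReward θ T W R t n x ∂P) / t) atTop
      (𝓝 ((∫ x, R x ∂P) / ∫ x, T x ∂P)) := by
  have hm := tendsto_renewalFun_div hθ hT hTi hT0 hpos hind
  set μ := ∫ x, T x ∂P with hμ
  set g := ∫ x, R x ∂P with hg
  set c : ℝ → ℝ := fun t => ∫ x, ∑' n, cycleReward θ T W R t n x ∂P with hc
  have hμ' : 0 < μ⁻¹ := inv_pos.2 hpos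
  have hdiff : Tendsto (fun t => (c t - g * renewalFun P θ T t) / t) atTop (𝓝 0) := by
    rw [Metric.tendsto_nhds]
    intro δ hδ
    -- With ε = δμ/2 the first error term, divided by t, tends to δ/2.
    obtain ⟨L, K, hL0, hL⟩ := exists_abs_integral_tsum_sub_le hθ hT hTi hT0 hpos hind hW hW0 hR hRi
      (ε := δ * μ / 2) (by positivity)
    -- A shift by the fixed L does not change the growth rate, so the second error term is o(t).
    have hshift : Tendsto (fun t => renewalFun P θ T (t - L) / t) atTop (𝓝 μ⁻¹) := by
      have h1 := hm.comp (tendsto_atTop_add_const_right atTop (-L) tendsto_id)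
      have h2 : Tendsto (fun t : ℝ => 1 - L / t) atTop (𝓝 1) := by
        simpa using (tendsto_const_nhds (x := (1 : ℝ))).sub
          ((tendsto_const_nhds (x := L)).div_atTop tendsto_id)
      have h3 := h1.mul h2
      rw [mul_one] at h3
      refine h3.congr' ?_
      filter_upwards [eventually_gt_atTop L, eventually_gt_atTop 0] with t ht ht0
      have h5 : t - L ≠ 0 := by linarith
      simp only [Function.comp_apply, id, ← sub_eq_add_neg]
      field_simp
    have hlim : Tendsto (fun t => δ * μ / 2 * (renewalFun P θ T t / t) +
        K * (renewalFun P θ T t / t - renewalFun P θ T (t - L) / t)) atTop (𝓝 (δ / 2)) := by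
      have := (hm.const_mul (δ * μ / 2)).add ((hm.sub hshift).const_mul K)
      convert this using 2
      field_simp
      simp
    filter_upwards [eventually_gt_atTop 0, hlim.eventually (gt_mem_nhds (half_lt_self hδ))]
      with t ht h1
    rw [Real.dist_eq, sub_zero, abs_div, abs_of_pos ht]
    refine lt_of_le_of_lt ?_ h1
    rw [div_le_iff₀ ht]
    refine (hL t).trans (le_of_eq ?_)
    field_simp
  have := hdiff.add (hm.const_mul g)
  rw [zero_add, ← div_eq_mul_inv] at this
  refine this.congr fun t => ?_
  ring

end

end RenewalReward

/-! ### Ratios of partial sums along cycles -/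

lemma StrictMono.exists_le_lt_succ {κ : ℕ → ℕ} (hκ : StrictMono κ) (h0 : κ 0 = 0) (m : ℕ) :
    ∃ n, κ n ≤ m ∧ m < κ (n + 1) := by
  induction m with
  | zero => exact ⟨0, h0.le, (Nat.zero_le _).trans_lt (hκ (Nat.lt_succ_self 0))⟩
  | succ m ih =>
    obtain ⟨n, h1, h2⟩ := ih
    rcases Nat.lt_or_ge (m + 1) (κ (n + 1)) with h | h
    · exact ⟨n, by omega, h⟩
    · have h3 : κ (n + 1) < κ (n + 1 + 1) := hκ (Nat.lt_succ_self (n + 1))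
      exact ⟨n + 1, h, by omega⟩

/-- A quotient of partial sums that is only controlled up to the current cycle. -/
lemma tendsto_div_of_cycles {r s : ℕ → ℝ} {a b : ℝ} (hb : 0 < b)
    (hr : Tendsto (fun n : ℕ => r n / n) atTop (𝓝 a))
    (hs : Tendsto (fun n : ℕ => s n / n) atTop (𝓝 b))
    {ν : ℕ → ℕ} (hν : Tendsto ν atTop atTop) {e : ℕ → ℝ}
    (h1 : ∀ m, s (ν m) ≤ e m) (h2 : ∀ m, e m ≤ s (ν m + 1)) :
    Tendsto (fun m => r (ν m) / e m) atTop (𝓝 (a / b)) := by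
  have hs' : Tendsto (fun n : ℕ => s (n + 1) / n) atTop (𝓝 b) := by
    have h3 := hs.comp (tendsto_add_atTop_nat 1)
    have h4 : Tendsto (fun n : ℕ => 1 + 1 / (n : ℝ)) atTop (𝓝 1) := by
      simpa using (tendsto_const_nhds (x := (1 : ℝ))).add
        (tendsto_one_div_atTop_nhds_zero_nat (𝕜 := ℝ))
    have h5 := h3.mul h4
    rw [mul_one] at h5
    refine h5.congr' ?_
    filter_upwards [eventually_gt_atTop 0] with n hn
    have : (n : ℝ) ≠ 0 := by exact_mod_cast hn.ne'
    have : (n : ℝ) + 1 ≠ 0 := by positivity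
    simp only [Function.comp_apply]
    push_cast
    field_simp
  have he : Tendsto (fun m => e m / (ν m : ℝ)) atTop (𝓝 b) :=
    tendsto_of_tendsto_of_tendsto_of_le_of_le (hs.comp hν) (hs'.comp hν)
      (fun m => div_le_div_of_nonneg_right (h1 m) (Nat.cast_nonneg _))
      (fun m => div_le_div_of_nonneg_right (h2 m) (Nat.cast_nonneg _))
  refine ((hr.comp hν).div he hb.ne').congr' ?_
  filter_upwards [hν.eventually (eventually_gt_atTop 0)] with m hm
  have : (ν m : ℝ) ≠ 0 := by exact_mod_cast hm.ne'
  simp only [Pi.div_apply, Function.comp_apply]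
  rw [div_div_div_cancel_right₀ this]

/-- The sequence from its `k`-th entry on. -/
def seqShift {α : Type*} (k : ℕ) (x : ℕ → α) : ℕ → α := fun l => x (k + l)

/-- The first `k` entries of a sequence, padded by `a`. -/
def seqPast {α : Type*} (a : α) (k : ℕ) (x : ℕ → α) : ℕ → α := fun l => if l < k then x l else a

/-! ### Pathwise decomposition into cycles -/

namespace IVM

variable {J : ℕ} (M : IVM J) (U : Set M.State)

/-- The number of units by which a state is below the full machine. -/
def level (i : M.State) : ℕ := (∑ j, (M.Q j - i.1 j)).toNat

lemma sum_sub_nonneg (i : M.State) : 0 ≤ ∑ j, (M.Q j - i.1 j) :=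
  Finset.sum_nonneg fun j _ => sub_nonneg.2 (i.2 j)

lemma level_full : M.level M.full = 0 := by simp [level, full]

lemma level_dec (i : M.State) (j : Fin J) : M.level (M.dec i j) = M.level i + 1 := by
  have h : ∑ l, (M.Q l - (M.dec i j).1 l) = (∑ l, (M.Q l - i.1 l)) + 1 := by
    have : ∀ l, M.Q l - (M.dec i j).1 l = (M.Q l - i.1 l) + (Pi.single j 1 : Fin J → ℤ) l := by
      intro l
      simp only [dec, Pi.sub_apply]
      ring
    simp_rw [this]
    rw [Finset.sum_add_distrib, Finset.sum_pi_single']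
    simp
  have h0 := M.sum_sub_nonneg i
  unfold level
  omega

lemma sub_le_level (i : M.State) (j : Fin J) : M.Q j - i.1 j ≤ M.level i := by
  unfold level
  rw [Int.toNat_of_nonneg (M.sum_sub_nonneg i)]
  exact Finset.single_le_sum (f := fun l => M.Q l - i.1 l) (fun l _ => sub_nonneg.2 (i.2 l))
    (Finset.mem_univ j)

lemma eq_full_of_level_eq_zero {i : M.State} (h : M.level i = 0) : i = M.full := by
  refine Subtype.ext (funext fun j => ?_)
  have h1 := M.sub_le_level i j
  have h2 : i.1 j ≤ M.Q j := i.2 j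
  simp only [full]
  omega

variable {M U} {x y : ℕ → Step J}

lemma state_succ_of_mem {k : ℕ} (h : M.state U x k ∈ U) : M.state U x (k + 1) = M.full := by
  simp only [state]; rw [if_pos h]

lemma state_succ_of_notMem {k : ℕ} (h : M.state U x k ∉ U) :
    M.state U x (k + 1) = M.dec (M.state U x k) (x k).1 := by
  simp only [state]; rw [if_neg h]

lemma state_congr {k : ℕ} (h : ∀ l < k, x l = y l) : M.state U x k = M.state U y k := by
  induction k with
  | zero => rfl
  | succ k ih =>
    have := ih fun l hl => h l (hl.trans (Nat.lt_succ_self k))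
    by_cases hk : M.state U x k ∈ U
    · rw [state_succ_of_mem hk, state_succ_of_mem (this ▸ hk)]
    · rw [state_succ_of_notMem hk, state_succ_of_notMem (this ▸ hk), this,
        h k (Nat.lt_succ_self k)]

lemma state_seqPast (s : Step J) {k l : ℕ} (h : l ≤ k) :
    M.state U (seqPast s k x) l = M.state U x l :=
  state_congr fun m hm => by rw [seqPast, if_pos (by omega)]

/-- Step l itself reads entry l, so l < k is needed here, whereas `state_seqPast` also allows l = k.
-/
lemma holdTime_seqPast (s : Step J) {k l : ℕ} (h : l < k) :
    M.holdTime U (seqPast s k x) l = M.holdTime U x l := by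
  unfold holdTime
  rw [state_seqPast s h.le, seqPast, if_pos h]

lemma stepCost_seqPast (s : Step J) {k l : ℕ} (h : l < k) :
    M.stepCost U (seqPast s k x) l = M.stepCost U x l := by
  unfold stepCost
  rw [state_seqPast s h.le, seqPast, if_pos h]

lemma epoch_seqPast (s : Step J) {k l : ℕ} (h : l ≤ k) :
    M.epoch U (seqPast s k x) l = M.epoch U x l :=
  Finset.sum_congr rfl fun m hm => holdTime_seqPast s (by have := Finset.mem_range.1 hm; omega)

/-- The trigger step k uses up entry k, so the fresh copy of the process reads the entries from k +
1 on. -/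
lemma state_seqShift {k : ℕ} (h : M.state U x k ∈ U) (l : ℕ) :
    M.state U x (k + 1 + l) = M.state U (seqShift (k + 1) x) l := by
  induction l with
  | zero => exact state_succ_of_mem h
  | succ l ih =>
    rw [← add_assoc]
    by_cases hk : M.state U x (k + 1 + l) ∈ U
    · rw [state_succ_of_mem hk, state_succ_of_mem (ih ▸ hk)]
    · rw [state_succ_of_notMem hk, state_succ_of_notMem (ih ▸ hk), ih]
      rfl

variable (M U)

/-- No trigger state is visited before step `k`. -/
def Untriggered (x : ℕ → Step J) (k : ℕ) : Prop := ∀ l < k, M.state U x l ∉ U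

/-- The first step at which a trigger state is visited. -/
def firstTrigger (x : ℕ → Step J) : ℕ := sInf {k | M.state U x k ∈ U}

/-- A trigger state is visited at some step. -/
def Triggers (x : ℕ → Step J) : Prop := ∃ k, M.state U x k ∈ U

/-- The steps after the end of the first cycle. -/
def nextCycle (x : ℕ → Step J) : ℕ → Step J := seqShift (M.firstTrigger U x + 1) x

/-- The time until the trigger state of the first cycle is entered. -/
def waitTime (x : ℕ → Step J) : ℝ := M.epoch U x (M.firstTrigger U x)

/-- The duration of the first cycle. -/
def cycleTime (x : ℕ → Step J) : ℝ := M.epoch U x (M.firstTrigger U x + 1)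

/-- The cost of the first cycle. -/
def cycleCost (x : ℕ → Step J) : ℝ := M.stepCost U x (M.firstTrigger U x)

/-- The first step of the `n`-th cycle. -/
def cycleStart (n : ℕ) (x : ℕ → Step J) : ℕ :=
  birkhoffSum (M.nextCycle U) (fun y => M.firstTrigger U y + 1) n x

variable {M U}

lemma Triggers.state_mem (h : M.Triggers U x) : M.state U x (M.firstTrigger U x) ∈ U :=
  Nat.sInf_mem h

lemma untriggered_firstTrigger : M.Untriggered U x (M.firstTrigger U x) :=
  fun _ hl => Nat.notMem_of_lt_sInf hl

lemma firstTrigger_eq {k : ℕ} (h1 : M.Untriggered U x k) (h2 : M.state U x k ∈ U) :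
    M.firstTrigger U x = k := by
  refine le_antisymm (Nat.sInf_le h2) (not_lt.1 fun h => ?_)
  exact h1 _ h (Triggers.state_mem ⟨k, h2⟩)

lemma Untriggered.succ {k : ℕ} (h : M.Untriggered U x k) (h2 : M.state U x k ∉ U) :
    M.Untriggered U x (k + 1) := fun l hl => by
  rcases Nat.lt_succ_iff_lt_or_eq.1 hl with h3 | rfl
  · exact h l h3
  · exact h2

lemma Untriggered.mono {k l : ℕ} (h : M.Untriggered U x k) (hl : l ≤ k) :
    M.Untriggered U x l := fun m hm => h m (hm.trans_le hl)

/-- The level acts as a clock within a cycle. Hence a state is visited at most once in the first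
cycle, at a step known in advance, and its expected number of visits there is a probability. -/
lemma Untriggered.level_state {k : ℕ} (h : M.Untriggered U x k) :
    M.level (M.state U x k) = k := by
  induction k with
  | zero => exact M.level_full
  | succ k ih =>
    rw [state_succ_of_notMem (h k (Nat.lt_succ_self k)), level_dec, ih (h.mono (Nat.le_succ k))]

lemma untriggered_seqPast (s : Step J) {k l : ℕ} (h : l ≤ k) :
    M.Untriggered U (seqPast s k x) l ↔ M.Untriggered U x l :=
  forall₂_congr fun m hm => by rw [state_seqPast s (by omega)]

lemma cycleTime_eq (h : M.Triggers U x) : M.cycleTime U x = M.waitTime U x + M.tau := by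
  unfold cycleTime waitTime
  rw [epoch, Finset.sum_range_succ, ← epoch]
  congr 1
  unfold holdTime
  rw [if_pos h.state_mem]

lemma sum_stepCost_eq_zero {k : ℕ} (h : M.Untriggered U x k) :
    ∑ l ∈ Finset.range k, M.stepCost U x l = 0 := by
  refine Finset.sum_eq_zero fun l hl => ?_
  unfold stepCost
  rw [if_neg (h l (Finset.mem_range.1 hl))]

section Orbit

variable (hx : ∀ n, M.Triggers U ((M.nextCycle U)^[n] x))

include hx

/-- The induction peels off the first cycle rather than the last: the remaining path is a path of
the same process driven by `nextCycle U x`. -/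
lemma cycle_apply (n l : ℕ) :
    M.state U x (M.cycleStart U n x + l) = M.state U ((M.nextCycle U)^[n] x) l ∧
    x (M.cycleStart U n x + l) = (M.nextCycle U)^[n] x l := by
  induction n generalizing x with
  | zero => simp [cycleStart]
  | succ n ih =>
    have h0 : M.Triggers U x := hx 0
    have h := ih (x := M.nextCycle U x) (fun n => by simpa using hx (n + 1))
    simp only [cycleStart, birkhoffSum_succ', Function.iterate_succ_apply] at h ⊢
    rw [← h.1, ← h.2, add_assoc (M.firstTrigger U x + 1), state_seqShift h0.state_mem]
    exact ⟨rfl, rfl⟩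

lemma holdTime_cycleStart_add (n l : ℕ) :
    M.holdTime U x (M.cycleStart U n x + l) = M.holdTime U ((M.nextCycle U)^[n] x) l := by
  unfold holdTime
  rw [(cycle_apply hx n l).1, (cycle_apply hx n l).2]

lemma stepCost_cycleStart_add (n l : ℕ) :
    M.stepCost U x (M.cycleStart U n x + l) = M.stepCost U ((M.nextCycle U)^[n] x) l := by
  unfold stepCost
  rw [(cycle_apply hx n l).1, (cycle_apply hx n l).2]

omit hx in
lemma cycleStart_succ (n : ℕ) : M.cycleStart U (n + 1) x
    = M.cycleStart U n x + (M.firstTrigger U ((M.nextCycle U)^[n] x) + 1) :=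
  birkhoffSum_succ _ _ _ _

lemma epoch_cycleStart (n : ℕ) :
    M.epoch U x (M.cycleStart U n x) = birkhoffSum (M.nextCycle U) (M.cycleTime U) n x := by
  induction n with
  | zero => simp [cycleStart, epoch]
  | succ n ih =>
    rw [cycleStart_succ, birkhoffSum_succ, ← ih, epoch, Finset.sum_range_add]
    congr 1
    exact Finset.sum_congr rfl fun l _ => holdTime_cycleStart_add hx n l

lemma epoch_cycleStart_add (n l : ℕ) : M.epoch U x (M.cycleStart U n x + l)
    = birkhoffSum (M.nextCycle U) (M.cycleTime U) n x + M.epoch U ((M.nextCycle U)^[n] x) l := by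
  rw [← epoch_cycleStart hx, epoch, Finset.sum_range_add]
  congr 1
  exact Finset.sum_congr rfl fun l _ => holdTime_cycleStart_add hx n l

lemma sum_stepCost_cycleStart (n : ℕ) :
    ∑ k ∈ Finset.range (M.cycleStart U n x), M.stepCost U x k
      = birkhoffSum (M.nextCycle U) (M.cycleCost U) n x := by
  induction n with
  | zero => simp [cycleStart]
  | succ n ih =>
    rw [cycleStart_succ, birkhoffSum_succ, ← ih, Finset.sum_range_add]
    congr 1
    rw [Finset.sum_congr rfl fun l _ => stepCost_cycleStart_add hx n l, Finset.sum_range_succ,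
      sum_stepCost_eq_zero untriggered_firstTrigger, zero_add]
    rfl

omit hx in
lemma strictMono_cycleStart : StrictMono fun n => M.cycleStart U n x :=
  strictMono_nat_of_lt_succ fun n => by rw [cycleStart_succ]; omega

omit hx in
lemma exists_cycle (m : ℕ) : ∃ n l, m = M.cycleStart U n x + l ∧
    l ≤ M.firstTrigger U ((M.nextCycle U)^[n] x) := by
  obtain ⟨n, h1, h2⟩ := (strictMono_cycleStart (M := M) (U := U) (x := x)).exists_le_lt_succ
    (by simp [cycleStart]) m
  simp only [cycleStart_succ] at h2
  exact ⟨n, m - M.cycleStart U n x, by omega, by omega⟩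

/-- Cost arises only at trigger steps, and each cycle has exactly one, its last step; `g` enumerates
these steps. -/
lemma totalCost_eq_tsum_cycleReward (t : ℝ) : M.totalCost U x t
    = ∑' n, cycleReward (M.nextCycle U) (M.cycleTime U) (M.waitTime U) (M.cycleCost U) t n x := by
  let g : ℕ → ℕ := fun n => M.cycleStart U n x + M.firstTrigger U ((M.nextCycle U)^[n] x)
  have hg : Function.Injective g := by
    refine (strictMono_nat_of_lt_succ fun n => ?_).injective
    have := cycleStart_succ (M := M) (U := U) (x := x) n
    simp only [g]
    omega
  unfold totalCost
  rw [← hg.tsum_eq]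
  · refine tsum_congr fun n => ?_
    simp only [g]
    rw [epoch_cycleStart_add hx, stepCost_cycleStart_add hx]
    rfl
  · intro k hk
    have hU : M.state U x k ∈ U := by
      by_contra h
      refine hk ?_
      simp [stepCost, h]
    obtain ⟨n, l, rfl, hl⟩ := exists_cycle (M := M) (U := U) (x := x) k
    rw [(cycle_apply hx n l).1] at hU
    refine ⟨n, ?_⟩
    simp only [g]
    rw [firstTrigger_eq (untriggered_firstTrigger.mono hl) hU]

/-- The trigger step closes its cycle, so an unfinished cycle has cost zero and the numerator is
exactly the cost of the completed cycles. Only the elapsed time has to be squeezed between two cycle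
starts. -/
lemma tendsto_sum_stepCost_div_sum_holdTime (h0 : ∀ k, 0 ≤ M.holdTime U x k) {a b : ℝ}
    (hb : 0 < b)
    (hr : Tendsto (fun n : ℕ => birkhoffSum (M.nextCycle U) (M.cycleCost U) n x / n) atTop (𝓝 a))
    (hs : Tendsto (fun n : ℕ => birkhoffSum (M.nextCycle U) (M.cycleTime U) n x / n) atTop (𝓝 b)) :
    Tendsto (fun m => (∑ k ∈ Finset.range m, M.stepCost U x k) /
      ∑ k ∈ Finset.range m, M.holdTime U x k) atTop (𝓝 (a / b)) := by
  choose ν l hm hl using exists_cycle (M := M) (U := U) (x := x)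
  have hν : Tendsto ν atTop atTop := by
    refine tendsto_atTop.2 fun N => ?_
    filter_upwards [eventually_ge_atTop (M.cycleStart U N x)] with m hmN
    by_contra! hlt
    have h1 := (strictMono_cycleStart (M := M) (U := U) (x := x)).monotone (Nat.succ_le_of_lt hlt)
    have h2 := hm m
    have h3 := hl m
    simp only [Nat.succ_eq_add_one, cycleStart_succ] at h1
    omega
  have hmono : Monotone (M.epoch U x) := monotone_nat_of_le_succ fun n => by
    rw [epoch, epoch, Finset.sum_range_succ]; linarith [h0 n]
  refine (tendsto_div_of_cycles hb hr hs hν (e := M.epoch U x) (fun m => ?_)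
    (fun m => ?_)).congr fun m => ?_
  · rw [← epoch_cycleStart hx]
    refine hmono ?_
    have h2 := hm m
    omega
  · rw [← epoch_cycleStart hx]
    refine hmono ?_
    rw [cycleStart_succ]
    have h2 := hm m
    have h3 := hl m
    omega
  · rw [← epoch, ← sum_stepCost_cycleStart hx]
    congr 1
    conv_rhs => rw [hm m]
    rw [Finset.sum_range_add, Finset.sum_congr rfl fun k _ => stepCost_cycleStart_add hx (ν m) k,
      sum_stepCost_eq_zero (untriggered_firstTrigger.mono (hl m)), add_zero]

end Orbit

end IVM

/-! ### Moments of the exponential and Poisson laws -/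

/-- Multiplied by x, the exponential density becomes 1/r times the Gamma density with shape 2, which
has mass one. -/
lemma lintegral_ofReal_expMeasure {r : ℝ} (hr : 0 < r) :
    ∫⁻ x, ENNReal.ofReal x ∂(expMeasure r) = ENNReal.ofReal (1 / r) := by
  have hm : Measurable (gammaPDF 1 r) := (measurable_gammaPDFReal 1 r).ennreal_ofReal
  have hm2 : Measurable (gammaPDF 2 r) := (measurable_gammaPDFReal 2 r).ennreal_ofReal
  rw [expMeasure, gammaMeasure, lintegral_withDensity_eq_lintegral_mul _ hm
    ENNReal.measurable_ofReal]
  have : ∀ x, (gammaPDF 1 r * ENNReal.ofReal) x = ENNReal.ofReal (1 / r) * gammaPDF 2 r x := by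
    intro x
    rcases lt_or_ge x 0 with hx | hx
    · simp [gammaPDF_of_neg hx]
    · rw [Pi.mul_apply, gammaPDF_of_nonneg hx, gammaPDF_of_nonneg hx,
        ← ENNReal.ofReal_mul (by simp; positivity), ← ENNReal.ofReal_mul (by positivity)]
      congr 1
      have h2 : (2 : ℝ) - 1 = 1 := by norm_num
      simp only [Real.Gamma_one, Real.Gamma_two, Real.rpow_one, Real.rpow_two, sub_self,
        Real.rpow_zero, h2]
      field_simp
  simp_rw [this]
  rw [lintegral_const_mul _ hm2, lintegral_gammaPDF_eq_one two_pos hr, mul_one]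

lemma ae_nonneg_expMeasure (r : ℝ) : ∀ᵐ x ∂(expMeasure r), 0 ≤ x := by
  have hm : Measurable (gammaPDF 1 r) := (measurable_gammaPDFReal 1 r).ennreal_ofReal
  rw [expMeasure, gammaMeasure, ae_withDensity_iff hm]
  refine ae_of_all _ fun x hx => ?_
  by_contra! h
  exact hx (gammaPDF_of_neg h)

lemma integrable_natCast_poissonMeasure (r : ℝ≥0) :
    Integrable (fun n : ℕ => (n : ℝ)) (poissonMeasure r) := by
  rw [integrable_poissonMeasure_iff]
  rw [← summable_nat_add_iff 1]
  refine ((Real.summable_pow_div_factorial (r : ℝ)).mul_left (Real.exp (-r) * r)).congr fun n => ?_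
  rw [Nat.factorial_succ]
  push_cast
  have : ((n : ℝ) + 1) ≠ 0 := by positivity
  rw [Real.norm_of_nonneg (by positivity)]
  field_simp
  ring

/-! ### Past and future of an i.i.d. sequence -/

section Sequences

variable {α : Type*} [MeasurableSpace α]

lemma measurable_seqShift (k : ℕ) : Measurable (seqShift k : (ℕ → α) → ℕ → α) :=
  measurable_pi_lambda _ fun l => measurable_pi_apply (k + l)

variable (ν : Measure α) [IsProbabilityMeasure ν]

lemma measurePreserving_seqShift (k : ℕ) : MeasurePreserving (seqShift k)
    (Measure.infinitePi fun _ : ℕ => ν) (Measure.infinitePi fun _ : ℕ => ν) :=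
  ⟨measurable_seqShift k, Measure.map_infinitePi_infinitePi_of_inj (P := fun _ : ℕ => ν)
    (f := fun l : ℕ => k + l) (add_right_injective k)⟩

/-- The two maps read disjoint sets of coordinates, below k and from k on. -/
lemma indepFun_seqPast_seqShift (a : α) (k : ℕ) :
    IndepFun (seqPast a k) (seqShift k) (Measure.infinitePi fun _ : ℕ => ν) := by
  have h : iIndepFun (fun (l : ℕ) (x : ℕ → α) => x l) (Measure.infinitePi fun _ : ℕ => ν) :=
    iIndepFun_infinitePi (X := fun _ x => x) fun _ => measurable_id
  have h2 := indep_iSup_of_disjoint (fun l => (measurable_pi_apply (X := fun _ : ℕ => α)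
    l).comap_le) h.iIndep (S := Iio k) (T := Ici k)
    (Set.disjoint_left.2 fun l h1 h2 => not_lt.2 (Set.mem_Ici.1 h2) (Set.mem_Iio.1 h1))
  refine indep_of_indep_of_le_left (indep_of_indep_of_le_right h2 ?_) ?_
  · rw [← measurable_iff_comap_le]
    refine @measurable_pi_lambda _ _ _ (_) _ _ fun l => ?_
    exact (comap_measurable _).mono (le_iSup₂_of_le (k + l) (Set.mem_Ici.2 (Nat.le_add_right k l))
      le_rfl) le_rfl
  · rw [← measurable_iff_comap_le]
    refine @measurable_pi_lambda _ _ _ (_) _ _ fun l => ?_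
    by_cases hl : l < k
    · simp only [seqPast, if_pos hl]
      exact (comap_measurable _).mono (le_iSup₂_of_le l (Set.mem_Iio.2 hl) le_rfl) le_rfl
    · simp only [seqPast, if_neg hl]
      exact @measurable_const _ _ _ (_) _

/-- The hypothesis `hpast` expresses that A is decided by the first k entries; the padding value `a`
is immaterial. -/
lemma measure_inter_preimage_seqShift (a : α) {k : ℕ} {A B : Set (ℕ → α)} (hA : MeasurableSet A)
    (hpast : ∀ x, seqPast a k x ∈ A ↔ x ∈ A) (hB : MeasurableSet B) :
    (Measure.infinitePi fun _ : ℕ => ν) (A ∩ seqShift k ⁻¹' B)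
      = (Measure.infinitePi fun _ : ℕ => ν) A * (Measure.infinitePi fun _ : ℕ => ν) B := by
  have h := (indepFun_iff_measure_inter_preimage_eq_mul.1 (indepFun_seqPast_seqShift ν a k))
    A B hA hB
  have e : seqPast a k ⁻¹' A = A := by ext x; exact hpast x
  rwa [e, (measurePreserving_seqShift ν k).measure_preimage hB.nullMeasurableSet] at h

/-- Restricting to an event decided before step k does not bias entry k. This separates the arrival
in a state from the randomness used there. -/
lemma map_eval_restrict (a : α) {k : ℕ} {A : Set (ℕ → α)} (hA : MeasurableSet A)
    (hpast : ∀ x, seqPast a k x ∈ A ↔ x ∈ A) :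
    ((Measure.infinitePi fun _ : ℕ => ν).restrict A).map (fun x => x k)
      = (Measure.infinitePi fun _ : ℕ => ν) A • ν := by
  ext B hB
  rw [Measure.map_apply (measurable_pi_apply k) hB,
    Measure.restrict_apply (measurable_pi_apply k hB), inter_comm, Measure.smul_apply, smul_eq_mul]
  have h := measure_inter_preimage_seqShift ν a hA hpast
    (measurable_pi_apply (X := fun _ : ℕ => α) 0 hB)
  have e : (Measure.infinitePi fun _ : ℕ => ν) ((fun f => f 0) ⁻¹' B) = ν B :=
    (measurePreserving_eval_infinitePi (fun _ : ℕ => ν) 0).measure_preimage hB.nullMeasurableSet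
  rw [e] at h
  exact h

lemma setLIntegral_eval (a : α) {k : ℕ} {A : Set (ℕ → α)} (hA : MeasurableSet A)
    (hpast : ∀ x, seqPast a k x ∈ A ↔ x ∈ A) {f : α → ℝ≥0∞} (hf : Measurable f) :
    ∫⁻ x in A, f (x k) ∂(Measure.infinitePi fun _ : ℕ => ν)
      = (Measure.infinitePi fun _ : ℕ => ν) A * ∫⁻ s, f s ∂ν := by
  rw [← lintegral_map hf (measurable_pi_apply (X := fun _ : ℕ => α) k),
    map_eval_restrict ν a hA hpast, lintegral_smul_measure, smul_eq_mul]

lemma setIntegral_eval (a : α) {k : ℕ} {A : Set (ℕ → α)} (hA : MeasurableSet A)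
    (hpast : ∀ x, seqPast a k x ∈ A ↔ x ∈ A) {f : α → ℝ} (hf : Measurable f) :
    ∫ x in A, f (x k) ∂(Measure.infinitePi fun _ : ℕ => ν)
      = (Measure.infinitePi fun _ : ℕ => ν).real A * ∫ s, f s ∂ν := by
  rw [← integral_map (measurable_pi_apply (X := fun _ : ℕ => α) k).aemeasurable
    hf.aestronglyMeasurable, map_eval_restrict ν a hA hpast, integral_smul_measure, smul_eq_mul]
  rfl

end Sequences

/-! ### The law of one step and the mean trigger cost -/

namespace IVM

variable {J : ℕ} (M : IVM J)

lemma Lam_pos : 0 < M.Lam := M.total_pos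

lemma p_nonneg (j : Fin J) : 0 ≤ M.p j := div_nonneg (M.rate_nonneg j) M.Lam_pos.le

lemma sum_p : ∑ j, M.p j = 1 := by
  unfold p
  rw [← Finset.sum_div]
  exact div_self M.Lam_pos.ne'

include M in
lemma nonempty_item : Nonempty (Fin J) := by
  by_contra h
  rw [not_nonempty_iff] at h
  have := M.total_pos
  simp at this

include M in
lemma nonempty_step : Nonempty (Step J) := ⟨(M.nonempty_item.some, 0, 0)⟩

/-- The law of the demanded item. -/
def itemLaw : Measure (Fin J) := ∑ j, ENNReal.ofReal (M.p j) • Measure.dirac j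

instance : IsProbabilityMeasure M.itemLaw := ⟨by
  simp [itemLaw, ← ENNReal.ofReal_sum_of_nonneg fun j _ => M.p_nonneg j, M.sum_p]⟩

instance : IsProbabilityMeasure (expMeasure M.Lam) := isProbabilityMeasure_expMeasure M.Lam_pos

instance (j : Fin J) : IsProbabilityMeasure (M.leadLaw j) := by unfold leadLaw; infer_instance

lemma stepLaw_eq : M.stepLaw = M.itemLaw.prod ((expMeasure M.Lam).prod (Measure.pi M.leadLaw)) :=
  rfl

instance : IsProbabilityMeasure M.stepLaw := by rw [stepLaw_eq]; infer_instance

lemma measurePreserving_item : MeasurePreserving Prod.fst M.stepLaw M.itemLaw := by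
  rw [stepLaw_eq]; exact measurePreserving_fst

lemma measurePreserving_time :
    MeasurePreserving (fun s : Step J => s.2.1) M.stepLaw (expMeasure M.Lam) := by
  rw [stepLaw_eq]; exact measurePreserving_fst.comp measurePreserving_snd

lemma measurePreserving_lead (j : Fin J) :
    MeasurePreserving (fun s : Step J => s.2.2 j) M.stepLaw (M.leadLaw j) := by
  rw [stepLaw_eq]
  exact (measurePreserving_eval M.leadLaw j).comp (measurePreserving_snd.comp measurePreserving_snd)

open Classical in
lemma stepLaw_real_dec (m i : M.State) :
    M.stepLaw.real {s | M.dec i s.1 = m} = M.P m i := by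
  have h : M.stepLaw {s | M.dec i s.1 = m} = M.itemLaw {j | M.dec i j = m} :=
    M.measurePreserving_item.measure_preimage
      (MeasurableSet.of_discrete (s := {j | M.dec i j = m})).nullMeasurableSet
  rw [Measure.real, h, itemLaw, Measure.finsetSum_apply, ENNReal.toReal_sum (fun j _ => by
    rw [Measure.smul_apply]
    exact ENNReal.mul_ne_top ENNReal.ofReal_ne_top (measure_ne_top _ _))]
  unfold P
  refine Finset.sum_congr rfl fun j _ => ?_
  rw [Measure.smul_apply, Measure.dirac_apply, smul_eq_mul, ENNReal.toReal_mul,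
    ENNReal.toReal_ofReal (M.p_nonneg j)]
  by_cases hj : M.dec i j = m
  · simp [hj]
  · simp [hj, Ne.symm hj]

/-- The cost of a replenishment triggered in state `i`. -/
def triggerCost (i : M.State) (s : Step J) : ℝ :=
  M.A + ∑ j, M.b j * max ((s.2.2 j : ℝ) - (i.1 j : ℝ)) 0

lemma measurable_lead (j : Fin J) : Measurable fun s : Step J => (s.2.2 j : ℝ) :=
  (measurable_of_countable fun n : ℕ => (n : ℝ)).comp
    ((measurable_pi_apply j).comp (measurable_snd.comp measurable_snd))

lemma measurable_triggerCost (i : M.State) : Measurable (M.triggerCost i) := by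
  unfold triggerCost
  refine measurable_const.add (Finset.measurable_sum _ fun j _ => measurable_const.mul ?_)
  exact ((measurable_lead j).sub_const _).max measurable_const

lemma integrable_lead (j : Fin J) : Integrable (fun s : Step J => (s.2.2 j : ℝ)) M.stepLaw :=
  (M.measurePreserving_lead j).integrable_comp_of_integrable
    (integrable_natCast_poissonMeasure _)

lemma integrable_shortage (i : M.State) (j : Fin J) :
    Integrable (fun s : Step J => max ((s.2.2 j : ℝ) - (i.1 j : ℝ)) 0) M.stepLaw :=
  ((M.integrable_lead j).sub (integrable_const _)).sup (integrable_const 0)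

lemma integrable_triggerCost (i : M.State) : Integrable (M.triggerCost i) M.stepLaw :=
  (integrable_const _).add
    (integrable_finsetSum _ fun j _ => (M.integrable_shortage i j).const_mul _)

/-- The Poisson series over ℕ is extended to ℤ, where negative r have probability zero, and then cut
down to r ≥ i_j, below which the positive part vanishes. This covers negative i_j as well. -/
lemma integral_shortage (i : M.State) (j : Fin J) :
    ∫ s, max ((s.2.2 j : ℝ) - (i.1 j : ℝ)) 0 ∂M.stepLaw
      = ∑' r : Set.Ici (i.1 j), ((r : ℤ) - i.1 j : ℝ) * M.leadProb j r := by
  have h1 : ∫ s, max ((s.2.2 j : ℝ) - (i.1 j : ℝ)) 0 ∂M.stepLaw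
      = ∫ n : ℕ, max ((n : ℝ) - (i.1 j : ℝ)) 0 ∂(M.leadLaw j) := by
    rw [← (M.measurePreserving_lead j).map_eq, integral_map
      (M.measurePreserving_lead j).measurable.aemeasurable
      (measurable_of_countable _).aestronglyMeasurable]
  have h2 : ∀ n : ℕ, M.leadProb j n
      = Real.exp (-(M.rate j * M.tau).toNNReal) * (M.rate j * M.tau).toNNReal ^ n / n.factorial := by
    intro n
    have : {m : ℕ | (m : ℤ) = n} = {n} := by ext; simp
    rw [leadProb, this, leadLaw, poissonMeasure_real_singleton]
  rw [h1, leadLaw, integral_poissonMeasure]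
  simp_rw [← h2, smul_eq_mul]
  have h3 : ∀ n : ℕ, M.leadProb j n * max ((n : ℝ) - (i.1 j : ℝ)) 0
      = (fun r : ℤ => M.leadProb j r * max ((r : ℝ) - (i.1 j : ℝ)) 0) n := fun n => by simp
  simp_rw [h3]
  have hinj : Function.Injective (Nat.cast : ℕ → ℤ) := Nat.cast_injective
  rw [hinj.tsum_eq (f := fun r : ℤ => M.leadProb j r * max ((r : ℝ) - (i.1 j : ℝ)) 0)]
  · rw [← tsum_subtype_eq_of_support_subset (s := Set.Ici (i.1 j))]
    · refine tsum_congr fun r => ?_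
      have : (i.1 j : ℝ) ≤ (r : ℤ) := by exact_mod_cast r.2
      rw [max_eq_left (sub_nonneg.2 this), mul_comm]
    · intro r hr
      by_contra h
      refine hr ?_
      have : (r : ℝ) ≤ (i.1 j : ℝ) := by exact_mod_cast (not_le.1 h).le
      simp only
      rw [max_eq_right (sub_nonpos.2 this), mul_zero]
  · intro r hr
    by_contra h
    refine hr ?_
    have : {n : ℕ | (n : ℤ) = r} = ∅ := by
      ext n
      simp only [mem_ofPred_eq, mem_empty_iff_false, iff_false]
      exact fun e => h ⟨n, e⟩
    simp [leadProb, this]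

lemma integral_triggerCost (i : M.State) : ∫ s, M.triggerCost i s ∂M.stepLaw = M.G i := by
  unfold triggerCost G
  rw [integral_add (integrable_const _)
    (integrable_finsetSum _ fun j _ => (M.integrable_shortage i j).const_mul _),
    integral_finsetSum _ fun j _ => (M.integrable_shortage i j).const_mul _]
  simp_rw [integral_const_mul, integral_shortage]
  simp

/-- The mean trigger cost grows at most linearly in the level. -/
lemma exists_lintegral_triggerCost_le : ∃ a b : ℝ≥0, ∀ i : M.State,
    ∫⁻ s, ‖M.triggerCost i s‖ₑ ∂M.stepLaw ≤ a + b * M.level i := by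
  let B : ℝ := ∑ j, |M.b j|
  let C : ℝ := |M.A| + ∑ j, |M.b j| * ((∫ s, (s.2.2 j : ℝ) ∂M.stepLaw) + |(M.Q j : ℝ)|)
  have hB : 0 ≤ B := Finset.sum_nonneg fun j _ => abs_nonneg _
  have hl : ∀ j, 0 ≤ ∫ s, (s.2.2 j : ℝ) ∂M.stepLaw := fun j =>
    integral_nonneg fun s => Nat.cast_nonneg _
  have hC : 0 ≤ C := add_nonneg (abs_nonneg _) (Finset.sum_nonneg fun j _ =>
    mul_nonneg (abs_nonneg _) (add_nonneg (hl j) (abs_nonneg _)))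
  refine ⟨C.toNNReal, B.toNNReal, fun i => ?_⟩
  have hint : ∀ j, Integrable (fun s : Step J =>
      |M.b j| * ((s.2.2 j : ℝ) + (|(M.Q j : ℝ)| + M.level i))) M.stepLaw := fun j =>
    ((M.integrable_lead j).add (integrable_const _)).const_mul _
  -- At most `level i` units of item j are missing, so −i_j ≤ |Q_j| + `level i`, which bounds the
  -- shortage.
  have hpt : ∀ s, ‖M.triggerCost i s‖ ≤
      |M.A| + ∑ j, |M.b j| * ((s.2.2 j : ℝ) + (|(M.Q j : ℝ)| + M.level i)) := by
    intro s
    refine (norm_add_le _ _).trans (add_le_add le_rfl ((norm_sum_le _ _).trans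
      (Finset.sum_le_sum fun j _ => ?_)))
    rw [norm_mul]
    refine mul_le_mul_of_nonneg_left ?_ (abs_nonneg _)
    rw [Real.norm_of_nonneg (le_max_right _ _)]
    have h1 : ((M.Q j - i.1 j : ℤ) : ℝ) ≤ (M.level i : ℤ) := by exact_mod_cast M.sub_le_level i j
    push_cast at h1
    have h2 := neg_abs_le (M.Q j : ℝ)
    refine max_le (by linarith) (by positivity)
  have hreal : ∫ s, ‖M.triggerCost i s‖ ∂M.stepLaw ≤ C + B * M.level i := by
    refine (integral_mono (M.integrable_triggerCost i).norm
      ((integrable_const _).add (integrable_finsetSum _ fun j _ => hint j)) hpt).trans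
      (le_of_eq ?_)
    simp only [Pi.add_apply]
    rw [integral_add (integrable_const _) (integrable_finsetSum _ fun j _ => hint j),
      integral_finsetSum _ fun j _ => hint j]
    simp_rw [integral_const_mul]
    have : ∀ j, ∫ s, ((s.2.2 j : ℝ) + (|(M.Q j : ℝ)| + M.level i)) ∂M.stepLaw
        = (∫ s, (s.2.2 j : ℝ) ∂M.stepLaw) + (|(M.Q j : ℝ)| + M.level i) := fun j => by
      rw [integral_add (M.integrable_lead j) (integrable_const _)]; simp
    simp_rw [this]
    simp only [integral_const, probReal_univ, smul_eq_mul, one_mul, C, B, Finset.sum_mul]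
    rw [add_assoc, ← Finset.sum_add_distrib]
    congr 1
    exact Finset.sum_congr rfl fun j _ => by ring
  rw [← ofReal_integral_norm_eq_lintegral_enorm (M.integrable_triggerCost i)]
  refine (ENNReal.ofReal_le_ofReal hreal).trans (le_of_eq ?_)
  rw [ENNReal.ofReal_add hC (by positivity), ENNReal.ofReal_mul hB, ENNReal.ofReal_natCast]
  rfl

end IVM

/-! ### Measurability of the cycle quantities -/

lemma measurable_apply_nat {X β : Type*} [MeasurableSpace X] [MeasurableSpace β] {N : X → ℕ}
    (hN : Measurable N) {f : ℕ → X → β} (hf : ∀ k, Measurable (f k)) :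
    Measurable fun x => f (N x) x :=
  (measurable_from_prod_countable_right (f := fun q : ℕ × X => f q.1 q.2) hf).comp
    (hN.prodMk measurable_id)

lemma hasSum_measureReal_iUnion {X ι : Type*} [MeasurableSpace X] [Countable ι] {P : Measure X}
    [IsFiniteMeasure P] {s : ι → Set X} (hs : ∀ i, MeasurableSet (s i))
    (hd : Pairwise (Function.onFun Disjoint s)) :
    HasSum (fun i => P.real (s i)) (P.real (⋃ i, s i)) := by
  simpa using hasSum_integral_iUnion hs hd (integrable_const (1 : ℝ)).integrableOn (μ := P)

namespace IVM

variable {J : ℕ} (M : IVM J) (U : Set M.State)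

/-- The law of the sequence of all steps. -/
def seqLaw : Measure (ℕ → Step J) := Measure.infinitePi fun _ => M.stepLaw

instance : IsProbabilityMeasure M.seqLaw := by unfold seqLaw; infer_instance

variable {M} in
lemma IsDriving.map_eq {Ω : Type*} [MeasurableSpace Ω] {μ : Measure Ω} [IsProbabilityMeasure μ]
    {ξ : ℕ → Ω → Step J} (h : M.IsDriving μ ξ) : μ.map (fun ω k => ξ k ω) = M.seqLaw := by
  rw [h.indep.map_fun_eq_infinitePi_map h.meas, seqLaw]
  simp_rw [h.law]

lemma measurable_state (k : ℕ) : Measurable fun x => M.state U x k := by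
  induction k with
  | zero => exact measurable_const
  | succ k ih =>
    have h : Measurable fun q : M.State × Fin J => by
        classical exact if q.1 ∈ U then M.full else M.dec q.1 q.2 := Measurable.of_discrete
    exact h.comp (ih.prodMk (measurable_fst.comp (measurable_pi_apply k)))

lemma measurableSet_state_mem (k : ℕ) (S : Set M.State) : MeasurableSet {x | M.state U x k ∈ S} :=
  M.measurable_state U k MeasurableSet.of_discrete

lemma measurable_holdTime (k : ℕ) : Measurable fun x => M.holdTime U x k := by
  classical
  exact Measurable.ite (M.measurableSet_state_mem U k U) measurable_const
    (measurable_fst.comp (measurable_snd.comp (measurable_pi_apply k)))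

lemma measurable_stepCost (k : ℕ) : Measurable fun x => M.stepCost U x k := by
  classical
  refine Measurable.ite (M.measurableSet_state_mem U k U) ?_ measurable_const
  refine measurable_const.add (Finset.measurable_sum _ fun j _ => measurable_const.mul ?_)
  refine Measurable.max (Measurable.sub ?_ ?_) measurable_const
  · exact (measurable_lead j).comp (measurable_pi_apply k)
  · exact (Measurable.of_discrete (f := fun i : M.State => (i.1 j : ℝ))).comp
      (M.measurable_state U k)

lemma measurable_epoch (k : ℕ) : Measurable fun x => M.epoch U x k :=
  Finset.measurable_sum _ fun l _ => M.measurable_holdTime U l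

lemma measurableSet_untriggered (k : ℕ) : MeasurableSet {x | M.Untriggered U x k} := by
  have : {x | M.Untriggered U x k} = ⋂ l, ⋂ (_ : l < k), {x | M.state U x l ∈ Uᶜ} := by
    ext x; simp [Untriggered]
  rw [this]
  exact MeasurableSet.iInter fun l => MeasurableSet.iInter fun _ => M.measurableSet_state_mem U l _

/-- The first trigger state is visited at step `k`. -/
def triggerSet (k : ℕ) : Set (ℕ → Step J) := {x | M.Untriggered U x k ∧ M.state U x k ∈ U}

lemma measurableSet_triggerSet (k : ℕ) : MeasurableSet (M.triggerSet U k) :=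
  (M.measurableSet_untriggered U k).inter (M.measurableSet_state_mem U k U)

lemma iUnion_triggerSet : ⋃ k, M.triggerSet U k = {x | M.Triggers U x} := by
  ext x
  simp only [mem_iUnion]
  exact ⟨fun ⟨k, h⟩ => ⟨k, h.2⟩, fun h => ⟨_, untriggered_firstTrigger, h.state_mem⟩⟩

lemma measurableSet_triggers : MeasurableSet {x | M.Triggers U x} := by
  rw [← iUnion_triggerSet]
  exact MeasurableSet.iUnion (M.measurableSet_triggerSet U)

lemma pairwise_disjoint_triggerSet : Pairwise (Function.onFun Disjoint (M.triggerSet U)) :=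
  fun _ _ hkl => Set.disjoint_left.2 fun _ h1 h2 =>
    hkl ((firstTrigger_eq h1.1 h1.2).symm.trans (firstTrigger_eq h2.1 h2.2))

lemma measurable_firstTrigger : Measurable (M.firstTrigger U) := by
  refine measurable_to_countable' fun k => ?_
  -- The infimum of the empty set is 0, so the value 0 also collects the sequences that never
  -- trigger.
  have : M.firstTrigger U ⁻¹' {k} = M.triggerSet U k ∪ {x | k = 0 ∧ ¬ M.Triggers U x} := by
    ext x
    simp only [mem_preimage, mem_singleton_iff, mem_union]
    constructor
    · rintro rfl
      by_cases h : M.Triggers U x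
      · exact Or.inl ⟨untriggered_firstTrigger, h.state_mem⟩
      · refine Or.inr ⟨?_, h⟩
        rw [firstTrigger, Nat.sInf_eq_zero]
        exact Or.inr (Set.eq_empty_iff_forall_notMem.2 fun k hk => h ⟨k, hk⟩)
    · rintro (h | ⟨rfl, h⟩)
      · exact firstTrigger_eq h.1 h.2
      · rw [firstTrigger, Nat.sInf_eq_zero]
        exact Or.inr (Set.eq_empty_iff_forall_notMem.2 fun k hk => h ⟨k, hk⟩)
  rw [this]
  exact (M.measurableSet_triggerSet U k).union
    ((MeasurableSet.const _).inter (M.measurableSet_triggers U).compl)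

lemma measurable_nextCycle : Measurable (M.nextCycle U) :=
  measurable_apply_nat (M.measurable_firstTrigger U) (f := fun k x => seqShift (k + 1) x)
    fun k => measurable_seqShift (k + 1)

lemma measurable_waitTime : Measurable (M.waitTime U) :=
  measurable_apply_nat (M.measurable_firstTrigger U) (M.measurable_epoch U)

lemma measurable_cycleTime : Measurable (M.cycleTime U) :=
  measurable_apply_nat (M.measurable_firstTrigger U) fun k => M.measurable_epoch U (k + 1)

lemma measurable_cycleCost : Measurable (M.cycleCost U) :=
  measurable_apply_nat (M.measurable_firstTrigger U) (M.measurable_stepCost U)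

lemma seqPast_mem_triggerSet (s : Step J) (k : ℕ) (x : ℕ → Step J) :
    seqPast s (k + 1) x ∈ M.triggerSet U k ↔ x ∈ M.triggerSet U k := by
  simp only [triggerSet, mem_ofPred_eq]
  rw [untriggered_seqPast s (Nat.le_succ k), state_seqPast s (Nat.le_succ k)]

/-! ### Regeneration at the end of the first cycle -/

section CycleLaw

variable {M U} (htrig : ∀ᵐ x ∂M.seqLaw, M.Triggers U x)

include htrig

lemma measure_eq_tsum_inter_triggerSet {A : Set (ℕ → Step J)} (hA : MeasurableSet A) :
    M.seqLaw A = ∑' k, M.seqLaw (A ∩ M.triggerSet U k) := by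
  rw [← measure_iUnion (fun k l hkl => (M.pairwise_disjoint_triggerSet U hkl).mono
    inter_subset_right inter_subset_right)
    (fun k => hA.inter (M.measurableSet_triggerSet U k)), ← inter_iUnion, iUnion_triggerSet]
  exact (measure_congr (inter_ae_eq_left_of_ae_eq_univ (eventuallyEq_univ.2 htrig))).symm

/-- The strong Markov property. When the first trigger is at step k, `nextCycle` is the
deterministic shift by k + 1, and A has to be decided by the first k + 1 entries there. Sequences
without a trigger form a null set and impose no condition on A. -/
lemma measure_inter_preimage_nextCycle (s : Step J) {A B : Set (ℕ → Step J)} (hA : MeasurableSet A)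
    (hpast : ∀ k, ∀ x ∈ M.triggerSet U k, (seqPast s (k + 1) x ∈ A ↔ x ∈ A))
    (hB : MeasurableSet B) :
    M.seqLaw (A ∩ M.nextCycle U ⁻¹' B) = M.seqLaw A * M.seqLaw B := by
  rw [measure_eq_tsum_inter_triggerSet htrig (hA.inter (M.measurable_nextCycle U hB)),
    measure_eq_tsum_inter_triggerSet htrig hA, ← ENNReal.tsum_mul_right]
  refine tsum_congr fun k => ?_
  have e : A ∩ M.nextCycle U ⁻¹' B ∩ M.triggerSet U k
      = (A ∩ M.triggerSet U k) ∩ seqShift (k + 1) ⁻¹' B := by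
    ext x
    constructor
    · rintro ⟨⟨h1, h2⟩, h3⟩
      rw [mem_preimage, nextCycle, firstTrigger_eq h3.1 h3.2] at h2
      exact ⟨⟨h1, h3⟩, h2⟩
    · rintro ⟨⟨h1, h3⟩, h2⟩
      refine ⟨⟨h1, ?_⟩, h3⟩
      rwa [mem_preimage, nextCycle, firstTrigger_eq h3.1 h3.2]
  rw [e]
  refine measure_inter_preimage_seqShift M.stepLaw s (hA.inter (M.measurableSet_triggerSet U k))
    (fun x => ?_) hB
  constructor
  · rintro ⟨h1, h2⟩
    have h3 := (M.seqPast_mem_triggerSet U s k x).1 h2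
    exact ⟨(hpast k x h3).1 h1, h3⟩
  · rintro ⟨h1, h2⟩
    exact ⟨(hpast k x h2).2 h1, (M.seqPast_mem_triggerSet U s k x).2 h2⟩

lemma measurePreserving_nextCycle : MeasurePreserving (M.nextCycle U) M.seqLaw M.seqLaw := by
  refine ⟨M.measurable_nextCycle U, ?_⟩
  ext B hB
  rw [Measure.map_apply (M.measurable_nextCycle U) hB]
  have := measure_inter_preimage_nextCycle htrig M.nonempty_step.some MeasurableSet.univ
    (by simp) hB
  simpa using this

lemma indepFun_nextCycle (s : Step J) {F : (ℕ → Step J) → ℝ} (hF : Measurable F)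
    (hpast : ∀ k, ∀ x ∈ M.triggerSet U k, F (seqPast s (k + 1) x) = F x) :
    IndepFun F (M.nextCycle U) M.seqLaw := by
  rw [indepFun_iff_measure_inter_preimage_eq_mul]
  intro A B hA hB
  rw [(measurePreserving_nextCycle htrig).measure_preimage hB.nullMeasurableSet]
  refine measure_inter_preimage_nextCycle htrig s (hF hA) (fun k x hx => ?_) hB
  rw [mem_preimage, mem_preimage, hpast k x hx]

lemma indepFun_cycleTime : IndepFun (M.cycleTime U) (M.nextCycle U) M.seqLaw := by
  let s := M.nonempty_step.some
  refine indepFun_nextCycle htrig s (M.measurable_cycleTime U) fun k x hx => ?_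
  have h := (M.seqPast_mem_triggerSet U s k x).2 hx
  rw [cycleTime, cycleTime, firstTrigger_eq h.1 h.2, firstTrigger_eq hx.1 hx.2,
    epoch_seqPast s le_rfl]

lemma indepFun_cycleCost : IndepFun (M.cycleCost U) (M.nextCycle U) M.seqLaw := by
  let s := M.nonempty_step.some
  refine indepFun_nextCycle htrig s (M.measurable_cycleCost U) fun k x hx => ?_
  have h := (M.seqPast_mem_triggerSet U s k x).2 hx
  rw [cycleCost, cycleCost, firstTrigger_eq h.1 h.2, firstTrigger_eq hx.1 hx.2,
    stepCost_seqPast s (Nat.lt_succ_self k)]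

end CycleLaw

/-! ### Visit probabilities of the first cycle -/

/-- The state `i` is visited in the first cycle. -/
def visitSet (i : M.State) : Set (ℕ → Step J) :=
  {x | M.Untriggered U x (M.level i) ∧ M.state U x (M.level i) = i}

/-- The probability that `i` is visited in the first cycle. -/
def visitProb (i : M.State) : ℝ := M.seqLaw.real (M.visitSet U i)

lemma measurableSet_visitSet (i : M.State) : MeasurableSet (M.visitSet U i) :=
  (M.measurableSet_untriggered U _).inter (M.measurableSet_state_mem U _ {i})

lemma seqPast_mem_visitSet (s : Step J) (i : M.State) (x : ℕ → Step J) :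
    seqPast s (M.level i) x ∈ M.visitSet U i ↔ x ∈ M.visitSet U i := by
  simp only [visitSet, mem_ofPred_eq]
  rw [untriggered_seqPast s le_rfl, state_seqPast s le_rfl]

lemma visitProb_nonneg (i : M.State) : 0 ≤ M.visitProb U i := measureReal_nonneg

lemma visitProb_full : M.visitProb U M.full = 1 := by
  have : M.visitSet U M.full = univ := by
    ext x
    simp [visitSet, level_full, Untriggered, state]
  rw [visitProb, this, probReal_univ]

variable {M U}

lemma mem_visitSet_state {x : ℕ → Step J} {k : ℕ} (h : M.Untriggered U x k) :
    x ∈ M.visitSet U (M.state U x k) := by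
  unfold visitSet
  rw [mem_ofPred_eq, h.level_state]
  exact ⟨h, rfl⟩

lemma eq_of_mem_visitSet {x : ℕ → Step J} {i i' : M.State} (h : x ∈ M.visitSet U i)
    (h' : x ∈ M.visitSet U i') (hl : M.level i = M.level i') : i = i' := by
  rw [← h.2, ← h'.2, hl]

lemma firstTrigger_of_mem_visitSet {x : ℕ → Step J} {i : M.State} (h : x ∈ M.visitSet U i)
    (hi : i ∈ U) : M.firstTrigger U x = M.level i :=
  firstTrigger_eq h.1 (h.2.symm ▸ hi)

variable (M U)

/-- A visited trigger state ends the cycle, so two of them would both have level `firstTrigger`,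
that is, be visited at the same step. -/
lemma pairwise_disjoint_visitSet :
    Pairwise (Function.onFun Disjoint fun i : U => M.visitSet U i) :=
  fun i i' hne => Set.disjoint_left.2 fun _ h h' => hne (Subtype.ext (eq_of_mem_visitSet h h'
    ((firstTrigger_of_mem_visitSet h i.2).symm.trans (firstTrigger_of_mem_visitSet h' i'.2))))

lemma iUnion_visitSet : ⋃ i : U, M.visitSet U i = {x | M.Triggers U x} := by
  ext x
  simp only [mem_iUnion]
  constructor
  · rintro ⟨i, h⟩
    exact ⟨M.level i, h.2.symm ▸ i.2⟩
  · intro h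
    exact ⟨⟨_, h.state_mem⟩, mem_visitSet_state untriggered_firstTrigger⟩

lemma hasSum_visitProb_trigger (htrig : ∀ᵐ x ∂M.seqLaw, M.Triggers U x) :
    HasSum (fun i : U => M.visitProb U i) 1 := by
  have h := hasSum_measureReal_iUnion (P := M.seqLaw)
    (fun i : U => M.measurableSet_visitSet U i) (M.pairwise_disjoint_visitSet U)
  rw [iUnion_visitSet] at h
  have : M.seqLaw.real {x | M.Triggers U x} = 1 := by
    rw [Measure.real, (mem_ae_iff_prob_eq_one (M.measurableSet_triggers U)).1 htrig]; rfl
  rwa [this] at h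

/-- The visit probabilities satisfy the balance equation outside of the full state. -/
lemma hasSum_visitProb {m : M.State} (hm : m ≠ M.full) :
    HasSum (fun i : (Uᶜ : Set M.State) => M.P m i * M.visitProb U i) (M.visitProb U m) := by
  let s₀ := M.nonempty_step.some
  -- `A i` is the event of entering m from i. All possible predecessors have level `level m - 1` and
  -- hence compete for the same step, so these events are disjoint.
  let A : (Uᶜ : Set M.State) → Set (ℕ → Step J) := fun i =>
    M.visitSet U i ∩ {x | M.dec i (x (M.level i)).1 = m}
  have hitem : ∀ i : M.State, MeasurableSet {s : Step J | M.dec i s.1 = m} := fun i =>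
    M.measurePreserving_item.measurable (MeasurableSet.of_discrete (s := {j | M.dec i j = m}))
  have hAm : ∀ i, MeasurableSet (A i) := fun i => (M.measurableSet_visitSet U i).inter
    ((measurable_pi_apply (X := fun _ : ℕ => Step J) (M.level i.1)) (hitem i))
  have hlev : ∀ (i : (Uᶜ : Set M.State)) x, x ∈ A i → M.level i + 1 = M.level m := by
    rintro i x ⟨-, h2⟩
    rw [← level_dec, h2]
  have hAd : Pairwise (Function.onFun Disjoint A) := fun i i' hne =>
    Set.disjoint_left.2 fun x h h' => hne (Subtype.ext (eq_of_mem_visitSet h.1 h'.1 (by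
      have := hlev i x h
      have := hlev i' x h'
      omega)))
  have hAu : ⋃ i, A i = M.visitSet U m := by
    ext x
    simp only [mem_iUnion]
    constructor
    · rintro ⟨i, hx⟩
      have h := hlev i x hx
      obtain ⟨⟨h1, h2⟩, h3⟩ := hx
      have h4 : M.state U x (M.level i) ∉ U := by rw [h2]; exact i.2
      rw [visitSet, mem_ofPred_eq, ← h]
      refine ⟨h1.succ h4, ?_⟩
      rw [state_succ_of_notMem h4, h2]
      exact h3
    -- As m is not full, its level is positive, and the predecessor is the state one step earlier.
    · rintro ⟨h1, h2⟩
      obtain ⟨k, hk⟩ : ∃ k, M.level m = k + 1 :=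
        Nat.exists_eq_succ_of_ne_zero fun h => hm (M.eq_full_of_level_eq_zero h)
      rw [hk] at h1 h2
      have hkU := h1 k (Nat.lt_succ_self k)
      have h3 := h1.mono (Nat.le_succ k)
      refine ⟨⟨M.state U x k, hkU⟩, mem_visitSet_state h3, ?_⟩
      rw [mem_ofPred_eq, h3.level_state, ← h2, state_succ_of_notMem hkU]
  have h := hasSum_measureReal_iUnion (P := M.seqLaw) hAm hAd
  rw [hAu] at h
  change HasSum _ (M.seqLaw.real (M.visitSet U m))
  convert h using 2 with i
  have hev : Measurable fun x : ℕ → Step J => x (M.level i.1) :=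
    measurable_pi_apply (X := fun _ : ℕ => Step J) _
  have h1 := map_eval_restrict M.stepLaw s₀ (M.measurableSet_visitSet U i)
    (M.seqPast_mem_visitSet U s₀ i)
  have h2 := congrArg (fun ν : Measure (Step J) => ν {s | M.dec i s.1 = m}) h1
  simp only at h2
  rw [Measure.map_apply hev (hitem i), Measure.restrict_apply (hev (hitem i)), inter_comm,
    Measure.smul_apply, smul_eq_mul] at h2
  rw [← stepLaw_real_dec, mul_comm]
  simp only [visitProb, Measure.real, ← ENNReal.toReal_mul]
  exact (congrArg ENNReal.toReal h2).symm

end IVM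

namespace IVM

variable {J : ℕ} (M : IVM J) (U : Set M.State)

/-! ### Steps and waiting time as sums over visited states -/

section Visits

variable {M U}

open Classical in
/-- A sum over the continuation states visited in the first cycle is a sum over its steps. -/
lemma tsum_visitSet_eq_tsum_untriggered (x : ℕ → Step J) (f : ℕ → ℝ≥0∞) :
    ∑' i : (Uᶜ : Set M.State), (M.visitSet U i).indicator (fun _ => f (M.level i)) x
      = ∑' k, if M.Untriggered U x (k + 1) then f k else 0 := by
  -- The single term is spread into a sum over all steps, of which only k = `level i` can
  -- contribute; exchanging the sums then leaves one state for each step.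
  have h1 : ∀ i : (Uᶜ : Set M.State), (M.visitSet U i).indicator (fun _ => f (M.level i)) x
      = ∑' k, if M.Untriggered U x k ∧ M.state U x k = i then f k else 0 := by
    intro i
    rw [tsum_eq_single (M.level i)]
    · by_cases hx : x ∈ M.visitSet U i
      · rw [indicator_of_mem hx, if_pos ⟨hx.1, hx.2⟩]
      · rw [indicator_of_notMem hx, if_neg fun h => hx ⟨h.1, h.2⟩]
    · intro k hk
      rw [if_neg]
      rintro ⟨h, h2⟩
      exact hk (by rw [← h2, h.level_state])
  simp_rw [h1]
  rw [ENNReal.tsum_comm]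
  refine tsum_congr fun k => ?_
  by_cases hk : M.Untriggered U x (k + 1)
  · rw [if_pos hk, tsum_eq_single ⟨M.state U x k, hk k (Nat.lt_succ_self k)⟩]
    · rw [if_pos ⟨hk.mono (Nat.le_succ k), rfl⟩]
    · intro i hi
      rw [if_neg]
      rintro ⟨-, h2⟩
      exact hi (Subtype.ext h2.symm)
  · rw [if_neg hk, ENNReal.tsum_eq_zero]
    intro i
    rw [if_neg]
    rintro ⟨h, h2⟩
    exact hk (h.succ (by rw [h2]; exact i.2))

open Classical in
lemma Triggers.tsum_untriggered {x : ℕ → Step J} (h : M.Triggers U x) (f : ℕ → ℝ≥0∞) :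
    ∑' k, (if M.Untriggered U x (k + 1) then f k else 0)
      = ∑ k ∈ Finset.range (M.firstTrigger U x), f k := by
  have hiff : ∀ k, M.Untriggered U x (k + 1) ↔ k < M.firstTrigger U x := fun k =>
    ⟨fun hk => by
      by_contra hlt
      exact hk _ (by omega) h.state_mem, fun hk => untriggered_firstTrigger.mono hk⟩
  simp_rw [hiff]
  rw [tsum_eq_sum (s := Finset.range (M.firstTrigger U x))]
  · exact Finset.sum_congr rfl fun k hk => if_pos (Finset.mem_range.1 hk)
  · intro k hk
    rw [if_neg (by simpa using hk)]

lemma Triggers.triggerStep_eq {x : ℕ → Step J} (h : M.Triggers U x) :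
    M.triggerStep U x = M.firstTrigger U x := by
  refine le_antisymm (iInf₂_le (f := fun (k : ℕ) (_ : M.state U x k ∈ U) => (k : ℝ≥0∞))
    _ h.state_mem) (le_iInf₂ fun k hk => ?_)
  exact_mod_cast (Nat.sInf_le hk : M.firstTrigger U x ≤ k)

lemma triggerStep_eq_top {x : ℕ → Step J} (h : ¬ M.Triggers U x) : M.triggerStep U x = ∞ := by
  unfold triggerStep
  simp only [iInf_eq_top]
  exact fun k hk => absurd ⟨k, hk⟩ h

open Classical in
-- Step k is counted when the state at k is still a continuation state, hence the k + 1. Without a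
-- trigger both sides are infinite.
lemma triggerStep_eq_tsum (x : ℕ → Step J) :
    M.triggerStep U x = ∑' k, if M.Untriggered U x (k + 1) then 1 else 0 := by
  by_cases h : M.Triggers U x
  · rw [h.tsum_untriggered, h.triggerStep_eq]; simp
  · have : ∀ k, M.Untriggered U x (k + 1) := fun k l _ hl => h ⟨l, hl⟩
    simp only [this, if_true]
    rw [triggerStep_eq_top h, ENNReal.tsum_const_eq_top_of_ne_zero one_ne_zero]

variable (M U)

lemma measurable_triggerStep : Measurable (M.triggerStep U) := by
  classical
  rw [funext fun x => triggerStep_eq_tsum (M := M) (U := U) x]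
  exact Measurable.tsum fun k => Measurable.ite (M.measurableSet_untriggered U (k + 1))
    measurable_const measurable_const

lemma lintegral_triggerStep :
    ∫⁻ x, M.triggerStep U x ∂M.seqLaw
      = ∑' i : (Uᶜ : Set M.State), M.seqLaw (M.visitSet U i) := by
  classical
  simp_rw [triggerStep_eq_tsum, ← tsum_visitSet_eq_tsum_untriggered]
  rw [lintegral_tsum fun i : (Uᶜ : Set M.State) =>
    (measurable_const.indicator (M.measurableSet_visitSet U i)).aemeasurable]
  exact tsum_congr fun i => lintegral_indicator_one (M.measurableSet_visitSet U i)

/-- If there are finitely many continuation states, then the first cycle visits no more than these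
before a trigger state is entered. -/
lemma triggerStep_le_ncard (hU : (Uᶜ : Set M.State).Finite) (x : ℕ → Step J) :
    M.triggerStep U x ≤ (Uᶜ : Set M.State).ncard := by
  have hle : ∀ k, M.Untriggered U x k → k ≤ (Uᶜ : Set M.State).ncard := by
    intro k hk
    -- Different steps of a cycle have different levels, so no continuation state is repeated.
    have hinj : Set.InjOn (M.state U x) (Finset.range k) := fun a ha b hb hab => by
      rw [← (hk.mono (Finset.mem_range.1 ha).le).level_state,
        ← (hk.mono (Finset.mem_range.1 hb).le).level_state, hab]
    have := Set.ncard_le_ncard (s := M.state U x '' (Finset.range k)) (fun i hi => by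
      obtain ⟨l, hl, rfl⟩ := hi
      exact hk l (Finset.mem_range.1 hl)) hU
    rwa [hinj.ncard_image, Set.ncard_coe_finset, Finset.card_range] at this
  have h : M.Triggers U x := by
    by_contra h
    have := hle ((Uᶜ : Set M.State).ncard + 1) fun l _ hl => h ⟨l, hl⟩
    omega
  rw [h.triggerStep_eq]
  exact_mod_cast hle _ untriggered_firstTrigger

lemma ae_time_nonneg : ∀ᵐ x ∂M.seqLaw, ∀ k, 0 ≤ (x k).2.1 := by
  refine ae_all_iff.2 fun k => ?_
  have h := M.measurePreserving_time.comp
    (measurePreserving_eval_infinitePi (fun _ : ℕ => M.stepLaw) k)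
  exact h.quasiMeasurePreserving.ae (ae_nonneg_expMeasure M.Lam)

lemma ae_holdTime_nonneg : ∀ᵐ x ∂M.seqLaw, ∀ k, 0 ≤ M.holdTime U x k := by
  filter_upwards [M.ae_time_nonneg] with x hx k
  unfold holdTime
  split_ifs
  · exact M.tau_nonneg
  · exact hx k

lemma ae_waitTime_nonneg : ∀ᵐ x ∂M.seqLaw, 0 ≤ M.waitTime U x := by
  filter_upwards [M.ae_holdTime_nonneg U] with x hx
  unfold waitTime epoch
  exact Finset.sum_nonneg fun k _ => hx k

lemma ae_cycleTime_nonneg : ∀ᵐ x ∂M.seqLaw, 0 ≤ M.cycleTime U x := by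
  filter_upwards [M.ae_holdTime_nonneg U] with x hx
  unfold cycleTime epoch
  exact Finset.sum_nonneg fun k _ => hx k

lemma lintegral_time : ∫⁻ s, ENNReal.ofReal s.2.1 ∂M.stepLaw = ENNReal.ofReal (1 / M.Lam) := by
  rw [M.measurePreserving_time.lintegral_comp ENNReal.measurable_ofReal,
    lintegral_ofReal_expMeasure M.Lam_pos]

/-- Each visited continuation state contributes a waiting time of mean 1/Λ, independent of the
visit; summing over states gives Wald's identity, valid also when the mean number of steps is
infinite. -/
lemma lintegral_waitTime (htrig : ∀ᵐ x ∂M.seqLaw, M.Triggers U x) :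
    ∫⁻ x, ENNReal.ofReal (M.waitTime U x) ∂M.seqLaw
      = (∫⁻ x, M.triggerStep U x ∂M.seqLaw) * ENNReal.ofReal (1 / M.Lam) := by
  classical
  have hm : Measurable fun s : Step J => ENNReal.ofReal s.2.1 :=
    (measurable_fst.comp measurable_snd).ennreal_ofReal
  have hmi : ∀ i : M.State, Measurable fun y : ℕ → Step J =>
      ENNReal.ofReal (y (M.level i)).2.1 := fun i =>
    hm.comp (measurable_pi_apply (X := fun _ : ℕ => Step J) (M.level i))
  have h1 : ∀ᵐ x ∂M.seqLaw, ENNReal.ofReal (M.waitTime U x) = ∑' i : (Uᶜ : Set M.State),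
      (M.visitSet U i).indicator (fun y => ENNReal.ofReal (y (M.level i)).2.1) x := by
    filter_upwards [htrig, M.ae_time_nonneg] with x hx h0
    refine Eq.trans ?_ (tsum_visitSet_eq_tsum_untriggered x
      fun k => ENNReal.ofReal (x k).2.1).symm
    rw [hx.tsum_untriggered, ← ENNReal.ofReal_sum_of_nonneg fun k _ => h0 k]
    congr 1
    unfold waitTime epoch
    refine Finset.sum_congr rfl fun k hk => ?_
    unfold holdTime
    rw [if_neg (untriggered_firstTrigger k (Finset.mem_range.1 hk))]
  rw [lintegral_congr_ae h1, lintegral_tsum fun i : (Uᶜ : Set M.State) =>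
    ((hmi i).indicator (M.measurableSet_visitSet U i)).aemeasurable, lintegral_triggerStep,
    ← ENNReal.tsum_mul_right]
  refine tsum_congr fun i => ?_
  rw [← lintegral_time]
  refine Eq.trans ?_ (setLIntegral_eval M.stepLaw M.nonempty_step.some
    (M.measurableSet_visitSet U i) (M.seqPast_mem_visitSet U _ i) hm)
  rw [← lintegral_indicator (M.measurableSet_visitSet U i)]
  rfl

end Visits

/-! ### Mean duration and mean cost of a cycle -/

section Finite

variable {M U} (hfin : ∫⁻ x, M.triggerStep U x ∂M.seqLaw < ∞)

/-- The mean number of steps until a trigger state is first entered. -/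
def meanTriggerStep (M : IVM J) (U : Set M.State) : ℝ :=
  (∫⁻ x, M.triggerStep U x ∂M.seqLaw).toReal

include hfin

lemma ae_triggers : ∀ᵐ x ∂M.seqLaw, M.Triggers U x := by
  filter_upwards [ae_lt_top (M.measurable_triggerStep U) hfin.ne] with x hx
  by_contra h
  exact hx.ne (triggerStep_eq_top h)

lemma hasSum_visitProb_compl :
    HasSum (fun i : (Uᶜ : Set M.State) => M.visitProb U i) (M.meanTriggerStep U) := by
  have h := M.lintegral_triggerStep U
  rw [meanTriggerStep, h, ENNReal.tsum_toReal_eq fun i => measure_ne_top _ _]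
  rw [h] at hfin
  exact ENNReal.hasSum_toReal hfin.ne

lemma one_le_meanTriggerStep (hfull : M.full ∉ U) : 1 ≤ M.meanTriggerStep U := by
  rw [← M.visitProb_full U]
  exact le_hasSum (hasSum_visitProb_compl hfin) ⟨M.full, hfull⟩
    fun i _ => M.visitProb_nonneg U i

lemma hasSum_visitProb_all : HasSum (M.visitProb U) (1 + M.meanTriggerStep U) :=
  HasSum.add_compl (f := M.visitProb U) (s := U)
    (M.hasSum_visitProb_trigger U (ae_triggers hfin)) (hasSum_visitProb_compl hfin)

lemma integrable_waitTime : Integrable (M.waitTime U) M.seqLaw := by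
  refine ⟨(M.measurable_waitTime U).aestronglyMeasurable, ?_⟩
  rw [hasFiniteIntegral_iff_ofReal (M.ae_waitTime_nonneg U),
    M.lintegral_waitTime U (ae_triggers hfin)]
  exact ENNReal.mul_lt_top hfin ENNReal.ofReal_lt_top

lemma integral_waitTime : ∫ x, M.waitTime U x ∂M.seqLaw = 1 / M.Lam * M.meanTriggerStep U := by
  rw [integral_eq_lintegral_of_nonneg_ae (M.ae_waitTime_nonneg U)
    (M.measurable_waitTime U).aestronglyMeasurable, M.lintegral_waitTime U (ae_triggers hfin),
    ENNReal.toReal_mul, ENNReal.toReal_ofReal (one_div_nonneg.2 M.Lam_pos.le), mul_comm]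
  rfl

lemma ae_cycleTime_eq :
    (fun x => M.waitTime U x + M.tau) =ᵐ[M.seqLaw] M.cycleTime U := by
  filter_upwards [ae_triggers hfin] with x hx
  rw [cycleTime_eq hx]

lemma integrable_cycleTime : Integrable (M.cycleTime U) M.seqLaw :=
  ((integrable_waitTime hfin).add (integrable_const _)).congr (ae_cycleTime_eq hfin)

lemma integral_cycleTime :
    ∫ x, M.cycleTime U x ∂M.seqLaw = 1 / M.Lam * M.meanTriggerStep U + M.tau := by
  rw [← integral_congr_ae (ae_cycleTime_eq hfin),
    integral_add (integrable_waitTime hfin) (integrable_const _), integral_waitTime hfin]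
  simp

lemma integral_cycleTime_pos (hfull : M.full ∉ U) : 0 < ∫ x, M.cycleTime U x ∂M.seqLaw := by
  rw [integral_cycleTime hfin]
  have h1 := one_le_meanTriggerStep hfin hfull
  have h2 := M.Lam_pos
  have h3 := M.tau_nonneg
  positivity

omit hfin in
lemma cycleCost_eq_of_mem_visitSet {i : M.State} (hi : i ∈ U) {x : ℕ → Step J}
    (hx : x ∈ M.visitSet U i) : M.cycleCost U x = M.triggerCost i (x (M.level i)) := by
  rw [cycleCost, firstTrigger_of_mem_visitSet hx hi, stepCost, if_pos (by rw [hx.2]; exact hi),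
    hx.2]
  rfl

lemma restrict_iUnion_visitSet :
    M.seqLaw.restrict (⋃ i : U, M.visitSet U i) = M.seqLaw := by
  rw [iUnion_visitSet]
  exact Measure.restrict_eq_self_of_ae_mem (ae_triggers hfin)

/-- On the visit to a trigger state i the mean absolute cost is at most a + b · `level i`, and there
`level i` equals `triggerStep`. Summing over i leaves a + b times the mean number of steps, which is
finite. -/
lemma integrable_cycleCost : Integrable (M.cycleCost U) M.seqLaw := by
  refine ⟨(M.measurable_cycleCost U).aestronglyMeasurable, ?_⟩
  obtain ⟨a, b, hab⟩ := M.exists_lintegral_triggerCost_le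
  have hm := fun i : U => M.measurableSet_visitSet U i
  have hd := M.pairwise_disjoint_visitSet U
  have hbound : ∀ i : U, ∫⁻ x in M.visitSet U i, ‖M.cycleCost U x‖ₑ ∂M.seqLaw
      ≤ ∫⁻ x in M.visitSet U i, (a + b * M.triggerStep U x) ∂M.seqLaw := by
    intro i
    calc ∫⁻ x in M.visitSet U i, ‖M.cycleCost U x‖ₑ ∂M.seqLaw
        = ∫⁻ x in M.visitSet U i, ‖M.triggerCost i (x (M.level i))‖ₑ ∂M.seqLaw :=
          setLIntegral_congr_fun (hm i) fun x hx => by rw [cycleCost_eq_of_mem_visitSet i.2 hx]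
      _ = M.seqLaw (M.visitSet U i) * ∫⁻ s, ‖M.triggerCost i s‖ₑ ∂M.stepLaw :=
          setLIntegral_eval M.stepLaw M.nonempty_step.some (hm i) (M.seqPast_mem_visitSet U _ i)
            (M.measurable_triggerCost i).enorm
      _ ≤ M.seqLaw (M.visitSet U i) * (a + b * M.level i) := mul_le_mul_right (hab i) _
      _ = ∫⁻ x in M.visitSet U i, (a + b * M.level i) ∂M.seqLaw := by
          rw [setLIntegral_const, mul_comm]
      _ = ∫⁻ x in M.visitSet U i, (a + b * M.triggerStep U x) ∂M.seqLaw :=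
          setLIntegral_congr_fun (hm i) fun x hx => by
            have h : M.Triggers U x := ⟨M.level i, hx.2.symm ▸ i.2⟩
            simp only [h.triggerStep_eq, firstTrigger_of_mem_visitSet hx i.2]
  calc ∫⁻ x, ‖M.cycleCost U x‖ₑ ∂M.seqLaw
      = ∑' i : U, ∫⁻ x in M.visitSet U i, ‖M.cycleCost U x‖ₑ ∂M.seqLaw := by
        rw [← lintegral_iUnion hm hd, restrict_iUnion_visitSet hfin]
    _ ≤ ∑' i : U, ∫⁻ x in M.visitSet U i, (a + b * M.triggerStep U x) ∂M.seqLaw :=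
        ENNReal.tsum_le_tsum hbound
    _ = ∫⁻ x, (a + b * M.triggerStep U x) ∂M.seqLaw := by
        rw [← lintegral_iUnion hm hd, restrict_iUnion_visitSet hfin]
    _ < ∞ := by
        rw [lintegral_add_left measurable_const, lintegral_const_mul _ (M.measurable_triggerStep U)]
        simp only [lintegral_const, measure_univ, mul_one]
        exact ENNReal.add_lt_top.2 ⟨ENNReal.coe_lt_top, ENNReal.mul_lt_top ENNReal.coe_lt_top hfin⟩

/-- The cycle is split by the trigger state that ends it; the lead-time demands are independent of
the arrival there, so the mean cost given i is G(i). -/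
lemma hasSum_G_mul_visitProb :
    HasSum (fun i : U => M.G i * M.visitProb U i) (∫ x, M.cycleCost U x ∂M.seqLaw) := by
  have h := hasSum_integral_iUnion (fun i : U => M.measurableSet_visitSet U i)
    (M.pairwise_disjoint_visitSet U) (integrable_cycleCost hfin).integrableOn
  rw [restrict_iUnion_visitSet hfin] at h
  refine h.congr_fun fun i => ?_
  rw [setIntegral_congr_fun (M.measurableSet_visitSet U i)
    fun x hx => cycleCost_eq_of_mem_visitSet i.2 hx, ← integral_triggerCost, mul_comm]
  exact (setIntegral_eval M.stepLaw M.nonempty_step.some (M.measurableSet_visitSet U i)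
    (M.seqPast_mem_visitSet U _ i) (M.measurable_triggerCost i)).symm

end Finite

/-! ### Uniqueness and form of the stationary distribution -/

section Balance

lemma level_eq_of_P_ne_zero {m i : M.State} (h : M.P m i ≠ 0) : M.level m = M.level i + 1 := by
  unfold P at h
  obtain ⟨j, -, hj⟩ := Finset.exists_ne_zero_of_sum_ne_zero h
  by_cases hm : m = M.dec i j
  · rw [hm, level_dec]
  · rw [if_neg hm] at hj; exact absurd rfl hj

lemma P_full (i : M.State) : M.P M.full i = 0 := by
  by_contra h
  have := M.level_eq_of_P_ne_zero h
  rw [level_full] at this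
  omega

lemma delta_full : M.delta M.full = 1 := if_pos rfl

lemma delta_of_ne {m : M.State} (h : m ≠ M.full) : M.delta m = 0 := if_neg h

variable {M U}

/-- Every solution of the balance equations is determined by its value at the full state. -/
lemma SolvesBalance.eq_mul_visitProb {π : M.State → ℝ} (h : M.SolvesBalance U π) (m : M.State) :
    π m = π M.full * M.visitProb U m := by
  -- At m ≠ Q the balance equation involves only states of level one less, and the visit
  -- probabilities obey the same recursion.
  induction hn : M.level m using Nat.strong_induction_on generalizing m with
  | _ n ih =>
    by_cases hm : m = M.full
    · rw [hm, visitProb_full, mul_one]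
    · rw [h.2.1 m, M.delta_of_ne hm, zero_mul, zero_add, ← (M.hasSum_visitProb U hm).tsum_eq,
        ← tsum_mul_left]
      refine tsum_congr fun i => ?_
      by_cases hP : M.P m i = 0
      · rw [hP]; ring
      · have := M.level_eq_of_P_ne_zero hP
        rw [ih (M.level i) (by omega) i rfl]
        ring

lemma IsStationary.solvesBalance {π : M.State → ℝ} (h : M.IsStationary U π) :
    M.SolvesBalance U π := by
  obtain ⟨-, h1, h2⟩ := h
  refine ⟨h1.summable, fun m => ?_, ?_⟩
  · rw [← (h2 m).tsum_eq, ← (h2 m).summable.tsum_subtype_add_tsum_subtype_compl U]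
    rw [← tsum_mul_left]
    congr 1
    · exact tsum_congr fun i => by rw [PU, if_pos i.2]
    · exact tsum_congr fun i => by rw [PU, if_neg i.2]
  · rw [h1.summable.tsum_subtype_add_tsum_subtype_compl U, h1.tsum_eq]

/-- The normalized visit probabilities. -/
def stationary (M : IVM J) (U : Set M.State) (i : M.State) : ℝ :=
  M.visitProb U i / (1 + M.meanTriggerStep U)

lemma one_add_meanTriggerStep_pos : 0 < 1 + M.meanTriggerStep U := by
  have : 0 ≤ M.meanTriggerStep U := ENNReal.toReal_nonneg
  linarith

variable (hfin : ∫⁻ x, M.triggerStep U x ∂M.seqLaw < ∞)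

include hfin

lemma hasSum_stationary_trigger :
    HasSum (fun i : U => M.stationary U i) (1 / (1 + M.meanTriggerStep U)) :=
  (M.hasSum_visitProb_trigger U (ae_triggers hfin)).div_const _

lemma hasSum_stationary_compl : HasSum (fun i : (Uᶜ : Set M.State) => M.stationary U i)
    (M.meanTriggerStep U / (1 + M.meanTriggerStep U)) :=
  (hasSum_visitProb_compl hfin).div_const _

/-- No demand leads to the full state, so its inflow is the mass 1 / (1 + N) of the trigger states,
which matches v_Q = 1. Elsewhere the inflow comes from continuation states alone, by
`hasSum_visitProb`. -/
lemma isStationary_stationary : M.IsStationary U (M.stationary U) := by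
  have hZ := one_add_meanTriggerStep_pos (M := M) (U := U)
  refine ⟨fun i => div_nonneg (M.visitProb_nonneg U i) hZ.le, ?_, fun m => ?_⟩
  · have := (hasSum_visitProb_all hfin).div_const (1 + M.meanTriggerStep U)
    rwa [div_self hZ.ne'] at this
  · have hU : HasSum ((fun i => M.PU U m i * M.stationary U i) ∘ ((↑) : U → M.State))
        (M.delta m * (1 / (1 + M.meanTriggerStep U))) := by
      refine ((hasSum_stationary_trigger hfin).mul_left (M.delta m)).congr_fun ?_
      intro i
      simp only [Function.comp_apply, PU, if_pos i.2]
    by_cases hm : m = M.full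
    · subst hm
      have hc : HasSum ((fun i => M.PU U M.full i * M.stationary U i) ∘
          ((↑) : (Uᶜ : Set M.State) → M.State)) 0 := by
        refine (hasSum_zero (α := ℝ)).congr_fun fun i => ?_
        simp only [Function.comp_apply, PU, if_neg i.2, P_full, zero_mul]
      have := hU.add_compl hc
      rw [stationary, visitProb_full]
      rwa [delta_full, one_mul, add_zero] at this
    · have hc : HasSum ((fun i => M.PU U m i * M.stationary U i) ∘
          ((↑) : (Uᶜ : Set M.State) → M.State)) (M.stationary U m) := by
        refine ((M.hasSum_visitProb U hm).div_const (1 + M.meanTriggerStep U)).congr_fun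
          fun i => ?_
        simp only [Function.comp_apply, PU, if_neg i.2, stationary, mul_div_assoc]
      have := hU.add_compl hc
      rwa [M.delta_of_ne hm, zero_mul, zero_add] at this

lemma solvesBalance_iff (π : M.State → ℝ) : M.SolvesBalance U π ↔ π = M.stationary U := by
  refine ⟨fun h => ?_, fun h => h ▸ (isStationary_stationary hfin).solvesBalance⟩
  have hv := h.eq_mul_visitProb
  have h1 := h.2.2
  rw [tsum_congr fun i : U => hv i, tsum_congr fun i : (Uᶜ : Set M.State) => hv i,
    tsum_mul_left, tsum_mul_left, (hasSum_visitProb_compl hfin).tsum_eq,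
    (M.hasSum_visitProb_trigger U (ae_triggers hfin)).tsum_eq] at h1
  have hZ := one_add_meanTriggerStep_pos (M := M) (U := U)
  funext m
  -- The normalization `h1` reads π_Q (1 + N) = 1.
  rw [hv m, stationary, eq_div_iff hZ.ne']
  linear_combination M.visitProb U m * h1

lemma hasSum_G_mul_stationary : HasSum (fun i : U => M.G i * M.stationary U i)
    ((∫ x, M.cycleCost U x ∂M.seqLaw) / (1 + M.meanTriggerStep U)) := by
  simp only [stationary, ← mul_div_assoc]
  exact (hasSum_G_mul_visitProb hfin).div_const _

lemma denominator_eq : 1 / M.Lam * ∑' i : (Uᶜ : Set M.State), M.stationary U i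
    + M.tau * ∑' i : U, M.stationary U i
      = (∫ x, M.cycleTime U x ∂M.seqLaw) / (1 + M.meanTriggerStep U) := by
  rw [(hasSum_stationary_compl hfin).tsum_eq, (hasSum_stationary_trigger hfin).tsum_eq,
    integral_cycleTime hfin]
  ring

lemma costRatio_stationary : M.costRatio U (M.stationary U)
    = (∫ x, M.cycleCost U x ∂M.seqLaw) / ∫ x, M.cycleTime U x ∂M.seqLaw := by
  rw [costRatio, denominator_eq hfin, (hasSum_G_mul_stationary hfin).tsum_eq,
    div_div_div_cancel_right₀ one_add_meanTriggerStep_pos.ne']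

end Balance

/-! ### Long-run averages under the law of the step sequence -/

section LongRun

variable {M U} (hfull : M.full ∉ U) (hfin : ∫⁻ x, M.triggerStep U x ∂M.seqLaw < ∞)

include hfin

lemma ae_triggers_iterate : ∀ᵐ x ∂M.seqLaw, ∀ n, M.Triggers U ((M.nextCycle U)^[n] x) :=
  ae_forall_iterate (measurePreserving_nextCycle (ae_triggers hfin)) (ae_triggers hfin)

lemma ae_totalCost_eq (t : ℝ) : (fun x => ∑' n, cycleReward (M.nextCycle U) (M.cycleTime U)
    (M.waitTime U) (M.cycleCost U) t n x) =ᵐ[M.seqLaw] fun x => M.totalCost U x t := by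
  filter_upwards [ae_triggers_iterate hfin] with x hx
  rw [totalCost_eq_tsum_cycleReward hx]

include hfull

lemma integrable_totalCost (t : ℝ) : Integrable (fun x => M.totalCost U x t) M.seqLaw :=
  (integrable_tsum_cycleReward (measurePreserving_nextCycle (ae_triggers hfin))
    (M.measurable_cycleTime U) (integrable_cycleTime hfin) (M.ae_cycleTime_nonneg U)
    (integral_cycleTime_pos hfin hfull) (indepFun_cycleTime (ae_triggers hfin))
    (M.measurable_waitTime U) (M.ae_waitTime_nonneg U) (M.measurable_cycleCost U)
    (integrable_cycleCost hfin) t).congr (ae_totalCost_eq hfin t)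

lemma tendsto_integral_totalCost_div :
    Tendsto (fun t => (∫ x, M.totalCost U x t ∂M.seqLaw) / t) atTop
      (𝓝 (M.costRatio U (M.stationary U))) := by
  rw [costRatio_stationary hfin]
  simp_rw [← integral_congr_ae (ae_totalCost_eq hfin _)]
  exact tendsto_integral_tsum_cycleReward_div (measurePreserving_nextCycle (ae_triggers hfin))
    (M.measurable_cycleTime U) (integrable_cycleTime hfin) (M.ae_cycleTime_nonneg U)
    (integral_cycleTime_pos hfin hfull) (indepFun_cycleTime (ae_triggers hfin))
    (M.measurable_waitTime U) (M.ae_waitTime_nonneg U) (M.measurable_cycleCost U)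
    (integrable_cycleCost hfin)

lemma ae_tendsto_sum_stepCost_div : ∀ᵐ x ∂M.seqLaw, Tendsto (fun m : ℕ =>
    (∑ k ∈ Finset.range m, M.stepCost U x k) / ∑ k ∈ Finset.range m, M.holdTime U x k) atTop
      (𝓝 (M.costRatio U (M.stationary U))) := by
  have hθ := measurePreserving_nextCycle (ae_triggers hfin)
  filter_upwards [ae_triggers_iterate hfin, M.ae_holdTime_nonneg U,
    tendsto_birkhoffSum_div hθ (M.measurable_cycleCost U) (integrable_cycleCost hfin)
      (indepFun_cycleCost (ae_triggers hfin)),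
    tendsto_birkhoffSum_div hθ (M.measurable_cycleTime U) (integrable_cycleTime hfin)
      (indepFun_cycleTime (ae_triggers hfin))] with x hx h0 hr hs
  rw [costRatio_stationary hfin]
  exact tendsto_sum_stepCost_div_sum_holdTime hx h0 (integral_cycleTime_pos hfin hfull) hr hs

end LongRun

end IVM

end

theorem lemma1 {J : ℕ} (M : IVM J) (U : Set M.State) (hfull : M.full ∉ U)
    {Ω : Type*} [MeasurableSpace Ω] (μ : Measure Ω) [IsProbabilityMeasure μ]
    (ξ : ℕ → Ω → IVM.Step J) (hξ : M.IsDriving μ ξ) :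
    -- with finitely many continuation states, the mean number of steps to a trigger is finite
    (Uᶜ.Finite → ∫⁻ ω, M.triggerStep U (fun k => ξ k ω) ∂μ < ∞) ∧
    -- whenever that mean is finite, the average cost formula holds
    (∫⁻ ω, M.triggerStep U (fun k => ξ k ω) ∂μ < ∞ →
      ∃ π : M.State → ℝ,
        M.IsStationary U π ∧
        (∀ π' : M.State → ℝ, M.IsStationary U π' → π' = π) ∧
        (∀ π' : M.State → ℝ, M.SolvesBalance U π' ↔ π' = π) ∧
        Summable (fun i : U => M.G i * π i) ∧
        0 < 1 / M.Lam * ∑' i : (Uᶜ : Set M.State), π i + M.tau * ∑' i : U, π i ∧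
        -- long-run expected cost per unit of time
        (∀ t : ℝ, Integrable (fun ω => M.totalCost U (fun k => ξ k ω) t) μ) ∧
        Tendsto (fun t : ℝ => (∫ ω, M.totalCost U (fun k => ξ k ω) t ∂μ) / t) atTop
          (𝓝 (M.costRatio U π)) ∧
        -- ratio of the accumulated cost and time over the first `m` transitions
        (∀ᵐ ω ∂μ, Tendsto (fun m : ℕ =>
          (∑ k ∈ Finset.range m, M.stepCost U (fun k => ξ k ω) k) /
            ∑ k ∈ Finset.range m, M.holdTime U (fun k => ξ k ω) k) atTop
          (𝓝 (M.costRatio U π)))) := by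
  have hΦ : Measurable fun ω k => ξ k ω := measurable_pi_lambda _ hξ.meas
  have hmap := hξ.map_eq
  refine ⟨fun hU => ?_, fun hfin => ?_⟩
  · refine (lintegral_mono fun ω => M.triggerStep_le_ncard U hU _).trans_lt ?_
    simp
  -- All quantities are functionals of the sequence of steps, whose law is `seqLaw`, so the results
  -- carry over to any driving sequence.
  rw [← lintegral_map (M.measurable_triggerStep U) hΦ, hmap] at hfin
  have hint := IVM.integrable_totalCost hfull hfin
  refine ⟨M.stationary U, IVM.isStationary_stationary hfin,
    fun π' h => (IVM.solvesBalance_iff hfin π').1 h.solvesBalance, IVM.solvesBalance_iff hfin,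
    (IVM.hasSum_G_mul_stationary hfin).summable, ?_, fun t => ?_, ?_, ?_⟩
  · rw [IVM.denominator_eq hfin]
    exact div_pos (IVM.integral_cycleTime_pos hfin hfull) IVM.one_add_meanTriggerStep_pos
  · have h := hint t
    rw [← hmap] at h
    exact h.comp_measurable hΦ
  · refine (IVM.tendsto_integral_totalCost_div hfull hfin).congr fun t => ?_
    rw [← hmap, integral_map hΦ.aemeasurable]
    rw [hmap]
    exact (hint t).aestronglyMeasurable
  · have h := IVM.ae_tendsto_sum_stepCost_div hfull hfin
    rw [← hmap] at h
    exact ae_of_ae_map hΦ.aemeasurable h
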